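/- Let $r\ge 3$ be an odd integer, $q$ a prime power with $q\equiv 1 \pmod{r+1}$, $m\ge 1$, and $k=\mathbb F_{q^m}$. Let $\mathcal M_r$ be the affine curve over $k$ with coordinates $x,y,t$ given by $$y^2=x^3-x^2(t^{r+1}+1)+x\,t^{r+1},\qquad y=x^{\frac{r+1}{2}}+1,$$ and let $F=k(t,x)$ be its function field (the field of fractions of its coordinate ring), so that $$x^{r+1}+2x^{\frac{r+1}{2}}-x^3+x^2(t^{r+1}+1)-x\,t^{r+1}+1=0 .$$ For a place $P$ of $F/k$ let $v_P$ be the normalized discrete valuation, and for $P$ above the place $t=\infty$ of $k(t)$ let $e(P)$ and $f(P)$ be the ramification index and the relative degree over $t=\infty$. 1. Suppose $-1$ is a square in $k$, and let $i\in k$ with $i^2=-1$. Then there are exactly four places $P_1,P_2,P_3,P_4$ of $F$ above $t=\infty$, with $e(P_1)=e(P_2)=1$, $e(P_3)=e(P_4)=\frac{r-1}{2}$ and $f(P_j)=1$ for all $j$. They are labelled so that $t^{r+1}x-1\in P_1$, $x-1\in P_2$, $t^{-\frac{r+1}{2}}x^{\frac{r-1}{2}}-i\in P_3$ and $t^{-\frac{r+1}{2}}x^{\frac{r-1}{2}}+i\in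 P_4$ (that is, $P_1$, $P_2$ and $P_3,P_4$ correspond to the segments of slope $-(r+1)$, $0$ and $\frac{r+1}{r-1}$ of the Newton arc at $t=\infty$ of the above equation of $x$ over $k(t)$). Moreover $$v_{P_1}(x)=r+1,\qquad v_{P_2}(x)=0,\qquad v_{P_3}(x)=v_{P_4}(x)=-\frac{r+1}{2},$$ and the divisor of $x$ in $F$ is $(x)=(r+1)P_1-\frac{r+1}{2}P_3-\frac{r+1}{2}P_4$. 2. Suppose $-1$ is not a square in $k$. Then there are exactly three places $P_1,P_2,P_3$ of $F$ above $t=\infty$, with $e(P_1)=e(P_2)=1$, $f(P_1)=f(P_2)=1$, $e(P_3)=\frac{r-1}{2}$ and $f(P_3)=2$. They are labelled so that $t^{r+1}x-1\in P_1$, $x-1\in P_2$ and $\bigl(t^{-\frac{r+1}{2}}x^{\frac{r-1}{2}}\bigr)^2+1\in P_3$. Moreover $$v_{P_1}(x)=r+1,\qquad v_{P_2}(x)=0,\qquad v_{P_3}(x)=-\frac{r+1}{2},$$ and the divisor of $x$ in $F$ is $(x)=(r+1)P_1-\frac{r+1}{2}P_3$. -/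

import Mathlib

namespace LRCurve

open Polynomial

/-- A place of a field `F` over a field of constants `k`, given by its normalized discrete
valuation: a valuation of `F`, trivial on the nonzero constants, with value group exactly `ℤ`
(written multiplicatively, with `0` adjoined as the value of `0`). -/
@[ext]
structure Place (k F : Type*) [Field k] [Field F] [Algebra k F] where
  /-- the underlying (multiplicative) valuation -/
  val : Valuation F (WithZero (Multiplicative ℤ))
  surjective : Function.Surjective val
  map_const : ∀ c : k, c ≠ 0 → val (algebraMap k F c) = 1

namespace Place

variable {k K L : Type*} [Field k] [Field K] [Field L] [Algebra k K] [Algebra k L]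

/-- The normalized additive valuation `v_P(f)` of a nonzero element `f`
(the value at `f = 0` is irrelevant). -/
def ord (P : Place k L) (f : L) : ℤ := -WithZero.log (P.val f)

/-- `f` belongs to the maximal ideal of the valuation ring of `P`. -/
def Vanishes (P : Place k L) (f : L) : Prop := P.val f < 1

/-- The divisor `D` (a finite integral combination of places) is the principal divisor `(f)`:
`f` is nonzero and the coefficient of `D` at
every place is the valuation of `f` there. -/
def IsDivisorOf (D : Place k L →₀ ℤ) (f : L) : Prop :=
  f ≠ 0 ∧ ∀ P : Place k L, D P = P.ord f

variable [Algebra K L]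

/-- The place `P` of `L` lies over the place `Q` of `K`. -/
def LiesOver (P : Place k L) (Q : Place k K) : Prop := Q.val.HasExtension P.val

/-- `e` is the ramification index of `P` over `Q`. -/
def IsRamificationIndex (P : Place k L) (Q : Place k K) (e : ℕ) : Prop :=
  ∀ f : K, f ≠ 0 → P.ord (algebraMap K L f) = e * Q.ord f

/-- The relative degree of `P` over `Q`: the degree of the extension of residue fields. -/
noncomputable def relativeDegree (P : Place k L) (Q : Place k K) (h : P.LiesOver Q) : ℕ :=
  letI : Q.val.HasExtension P.val := h
  Module.finrank (IsLocalRing.ResidueField Q.val.valuationSubring)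
    (IsLocalRing.ResidueField P.val.valuationSubring)

/-- `P` lies over `Q` with ramification index `e` and relative degree `f`. -/
def LiesOverWith (P : Place k L) (Q : Place k K) (e f : ℕ) : Prop :=
  ∃ h : P.LiesOver Q, P.IsRamificationIndex Q e ∧ P.relativeDegree Q h = f

/-- Given a local parameter `τ` downstairs, a slope `-a / b` of a Newton arc and a lift `ψ` of an
irreducible factor of the residual polynomial of the segment of that slope, the place `P` belongs to
that factor if `ψ (τ ^ (-a) * s ^ b)` lies in `P`. -/
def BelongsTo (P : Place k L) (τ s : L) (a : ℤ) (b : ℕ) (ψ : k[X]) : Prop :=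
  P.Vanishes (aeval (τ ^ (-a) * s ^ b) ψ)

end Place

open Classical in
/-- The place `t = ∞` of the rational function field `k(t)`. -/
noncomputable def placeAtInfinity (k : Type*) [Field k] : Place k (RatFunc k) where
  val := RatFunc.inftyValuation k
  surjective := by
    intro y
    induction y using WithZero.expRecOn with
    | zero => exact ⟨0, map_zero _⟩
    | exp n => exact ⟨RatFunc.X ^ n, RatFunc.inftyValuation.X_zpow k n⟩
  map_const c hc := by
    have := RatFunc.inftyValuation.C k hc
    rwa [← RatFunc.algebraMap_eq_C] at this

section Curve

variable (k : Type*) [Field k] (r : ℕ)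

/-- The ideal of the affine curve
`y² = x³ - x²(t^(r+1) + 1) + x t^(r+1)`, `y = x^((r+1)/2) + 1`
in affine 3-space with coordinates `x = X 0`, `y = X 1`, `t = X 2`. -/
noncomputable def curveIdeal : Ideal (MvPolynomial (Fin 3) k) :=
  let x : MvPolynomial (Fin 3) k := MvPolynomial.X 0
  let y : MvPolynomial (Fin 3) k := MvPolynomial.X 1
  let t : MvPolynomial (Fin 3) k := MvPolynomial.X 2
  Ideal.span {y ^ 2 - (x ^ 3 - x ^ 2 * (t ^ (r + 1) + 1) + x * t ^ (r + 1)),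
    y - (x ^ ((r + 1) / 2) + 1)}

/-- The affine coordinate ring of the curve. Its field of fractions is the function field. -/
abbrev CoordRing : Type _ := MvPolynomial (Fin 3) k ⧸ curveIdeal k r

variable (F : Type*) [Field F] [Algebra (CoordRing k r) F]

/-- The coordinate function `x` in the function field. -/
noncomputable def xFun : F :=
  algebraMap (CoordRing k r) F (Ideal.Quotient.mk (curveIdeal k r) (MvPolynomial.X 0))

/-- The coordinate function `t` in the function field. -/
noncomputable def tFun : F :=
  algebraMap (CoordRing k r) F (Ideal.Quotient.mk (curveIdeal k r) (MvPolynomial.X 2))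

end Curve

end LRCurve

/-! Put r = 2N + 3. Eliminating y gives (x^(N+2) + 1)² = x(x - 1)(x - t^(2N+4)). Each of the three
Newton segments at t = ∞ has a chart, a pair (u, z) generating F over k: (1/t, x t^(2N+4)), (1/t, x)
and (t/x, t^(-(N+2)) x^(N+1)). There the equation becomes g ψ(z) = u h with g, h in k[u, z], where ψ
is X - 1, X - 1, or an irreducible factor of X² + 1, and g does not vanish at the point u = ψ(z) =
0. That point is therefore regular with local parameter u and residue field k[X]/(ψ), and exactly
one place is centred there (`exists_place`). As x and t are monomials in u and z, with z a unit at
the place, their valuations can be read off.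

Conversely, the sign of v(x) decides the chart of any place over t = ∞ (`val_firstChart`,
`val_sub_one_lt_one`, `val_thirdChart`). The cases v(x) > 0 and v(x) < 0 need no assumption on t, so
the same trichotomy determines the whole divisor of x.

Existence needs no degree count. Since t is transcendental, so is x (`transcendental_of_equation`),
and Chevalley's extension theorem gives valuation rings in which x, x - 1 or 1/x is a non-unit. If
-1 = i², the last one only gives z = i or z = -i; the endomorphism t ↦ ct of F with c^(N+2) = -1
sends z to -z and supplies the other. Such c exists because |k| ≡ 1 mod 2(N+2). -/

namespace LRCurve

open Polynomial WithZero

/-! ### Polynomials in u and z, reduced modulo u -/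

section Generators

variable {k F : Type*} [Field k] [Field F] [Algebra k F] {u z : F}

theorem exists_sub_aeval_eq_mul_of_mem_adjoin {f : F} (hf : f ∈ Algebra.adjoin k {u, z}) :
    ∃ p : k[X], ∃ f₁ ∈ Algebra.adjoin k {u, z}, f = aeval z p + u * f₁ := by
  have hu : u ∈ Algebra.adjoin k {u, z} := Algebra.subset_adjoin (by simp)
  have hz : z ∈ Algebra.adjoin k {u, z} := Algebra.subset_adjoin (by simp)
  have hp (p : k[X]) : aeval z p ∈ Algebra.adjoin k {u, z} :=
    Algebra.adjoin_mono (by simp) (aeval_mem_adjoin_singleton k z)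
  induction hf using Algebra.adjoin_induction with
  | mem x hx =>
    rcases hx with rfl | rfl
    · exact ⟨0, 1, one_mem _, by simp⟩
    · exact ⟨X, 0, zero_mem _, by simp⟩
  | algebraMap c => exact ⟨C c, 0, zero_mem _, by simp⟩
  | add a b _ _ ha hb =>
    obtain ⟨p, a₁, ha₁, ha⟩ := ha
    obtain ⟨q, b₁, hb₁, hb⟩ := hb
    exact ⟨p + q, a₁ + b₁, add_mem ha₁ hb₁, by rw [ha, hb, map_add]; ring⟩
  | mul a b _ _ ha hb =>
    obtain ⟨p, a₁, ha₁, ha⟩ := ha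
    obtain ⟨q, b₁, hb₁, hb⟩ := hb
    refine ⟨p * q, aeval z p * b₁ + a₁ * aeval z q + u * a₁ * b₁, ?_, ?_⟩
    · exact add_mem (add_mem (mul_mem (hp p) hb₁) (mul_mem ha₁ (hp q)))
        (mul_mem (mul_mem hu ha₁) hb₁)
    · rw [ha, hb, map_mul]; ring

variable {Γ : Type*} [LinearOrderedCommGroupWithZero Γ] {w : Valuation F Γ}

theorem val_le_one_of_mem_adjoin (hk : ∀ c : k, w (algebraMap k F c) ≤ 1) {s : Set F}
    (hs : ∀ x ∈ s, w x ≤ 1) {f : F} (hf : f ∈ Algebra.adjoin k s) : w f ≤ 1 := by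
  induction hf using Algebra.adjoin_induction with
  | mem x hx => exact hs x hx
  | algebraMap c => exact hk c
  | add a b _ _ ha hb => exact w.map_add_le ha hb
  | mul a b _ _ ha hb => rw [map_mul]; exact mul_le_one' ha hb

theorem val_aeval_le_one (hk : ∀ c : k, w (algebraMap k F c) ≤ 1) (hz : w z ≤ 1) (p : k[X]) :
    w (aeval z p) ≤ 1 :=
  val_le_one_of_mem_adjoin hk (s := {z}) (by simpa using hz) (aeval_mem_adjoin_singleton k z)

/-- If ψ did not divide p, a Bézout relation aψ + bp = 1, evaluated at z, would give 1 a value below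
1. -/
theorem val_aeval_lt_one_iff (hk : ∀ c : k, w (algebraMap k F c) ≤ 1) (hz : w z ≤ 1)
    {ψ : k[X]} (hψ : Irreducible ψ) (hψz : w (aeval z ψ) < 1) (p : k[X]) :
    w (aeval z p) < 1 ↔ ψ ∣ p := by
  constructor
  · intro h
    by_contra hd
    obtain ⟨a, b, hab⟩ := (hψ.coprime_iff_not_dvd).2 hd
    have := congrArg (fun q => w (aeval z q)) hab
    simp only [map_add, map_mul, map_one] at this
    refine absurd this (ne_of_lt (w.map_add_lt ?_ ?_))
    · rw [map_mul, mul_comm]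
      exact mul_lt_one_of_lt_of_le hψz (val_aeval_le_one hk hz a)
    · rw [map_mul, mul_comm]
      exact mul_lt_one_of_lt_of_le h (val_aeval_le_one hk hz b)
  · rintro ⟨q, rfl⟩
    rw [map_mul, map_mul]
    exact mul_lt_one_of_lt_of_le hψz (val_aeval_le_one hk hz q)

end Generators

/-! ### The place centred at a regular point -/

namespace Place

variable {k F : Type*} [Field k] [Field F] [Algebra k F]

theorem val_algebraMap_le_one (P : Place k F) (c : k) : P.val (algebraMap k F c) ≤ 1 := by
  by_cases hc : c = 0
  · simp [hc]
  · exact (P.map_const c hc).le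

/-- The value group is all of ℤ, so an element whose powers realise every value has valuation 1 or
-1; `hu` fixes the sign. -/
theorem val_eq_exp_neg_one (P : Place k F) {u : F} (hu : P.val u < 1)
    (h : ∀ f : F, f ≠ 0 → ∃ n : ℤ, P.val f = P.val u ^ n) : P.val u = exp (-1) := by
  obtain ⟨f, hf⟩ := P.surjective (exp (-1))
  obtain ⟨n, hn⟩ := h f (by rintro rfl; rw [map_zero] at hf; exact exp_ne_zero hf.symm)
  have hu0 : P.val u ≠ 0 := by
    intro h0
    rw [hf, h0] at hn
    rcases eq_or_ne n 0 with rfl | hn0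
    · rw [zpow_zero, ← exp_zero, exp_inj] at hn; omega
    · rw [zero_zpow n hn0] at hn; exact exp_ne_zero hn
  obtain ⟨j, hj⟩ : ∃ j : ℤ, P.val u = exp j := ⟨_, (exp_log hu0).symm⟩
  rw [hf, hj, ← exp_zsmul, exp_inj, smul_eq_mul] at hn
  rw [hj, ← exp_zero, exp_lt_exp] at hu
  rw [hj, exp_inj]
  rcases Int.isUnit_iff.1 (IsUnit.of_mul_eq_one (a := j) (-n) (by linarith [mul_comm n j])) with h | h <;> omega

end Place

/-- The centre of `w` on k[u, z] is generated by u and ψ(z). Since g is a unit there, the relation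
`hgh` makes u alone generate the maximal ideal of the local ring, which is thus a discrete valuation
ring. The valuation `w`, of arbitrary rank, only serves to show that the point u = ψ(z) = 0 exists.
-/
theorem exists_place {k F Γ : Type*} [Field k] [Field F] [Algebra k F]
    [LinearOrderedCommGroupWithZero Γ] {u z : F}
    (hgen : IntermediateField.adjoin k {u, z} = ⊤) (hu0 : u ≠ 0)
    {ψ : k[X]} (hψ : Irreducible ψ) (w : Valuation F Γ)
    (hwk : ∀ c : k, w (algebraMap k F c) ≤ 1) (hwu : w u < 1) (hwz : w z ≤ 1)
    (hwψ : w (aeval z ψ) < 1) {g h : F} (hg : g ∈ Algebra.adjoin k {u, z}) (hgw : w g = 1)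
    (hh : h ∈ Algebra.adjoin k {u, z}) (hgh : g * aeval z ψ = u * h) :
    ∃ P : Place k F, P.val u = exp (-1) ∧ P.val z ≤ 1 ∧ P.val (aeval z ψ) < 1 ∧
      (∀ f, P.val f ≤ 1 → ∃ p : k[X], P.val (f - aeval z p) < 1) ∧
      ∀ P' : Place k F, P'.val u < 1 → P'.val z ≤ 1 → P'.val (aeval z ψ) < 1 → P' = P := by
  set B := w.valuationSubring
  have hwB : w.IsEquiv B.valuation := w.isEquiv_valuation_valuationSubring
  have huB : B.valuation u < 1 := hwB.lt_one_iff_lt_one.1 hwu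
  have hzB : B.valuation z ≤ 1 := hwB.le_one_iff_le_one.1 hwz
  have hψB : B.valuation (aeval z ψ) < 1 := hwB.lt_one_iff_lt_one.1 hwψ
  have hgB : B.valuation g = 1 := hwB.eq_one_iff_eq_one.1 hgw
  set R := Algebra.adjoin k {u, z} with hR
  have hu : u ∈ R := Algebra.subset_adjoin (by simp)
  have hz : z ∈ R := Algebra.subset_adjoin (by simp)
  have hp (p : k[X]) : aeval z p ∈ R :=
    Algebra.adjoin_mono (by simp) (aeval_mem_adjoin_singleton k z)
  have hkB' (c : k) : B.valuation (algebraMap k F c) ≤ 1 := hwB.le_one_iff_le_one.1 (hwk c)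
  have hRB (f : F) (hf : f ∈ R) : f ∈ B := by
    rw [← B.valuation_le_one_iff]
    exact val_le_one_of_mem_adjoin hkB' (by
      rintro x (rfl | rfl)
      exacts [huB.le, hzB]) hf
  have : IsNoetherianRing R := by
    have : Algebra.FiniteType k R :=
      (Subalgebra.fg_iff_finiteType R).1 (by
        rw [hR]; exact ⟨({u, z} : Set F).toFinite.toFinset, by simp⟩)
    exact Algebra.FiniteType.isNoetherianRing k R
  have : IsFractionRing R F := by
    refine .of_field _ _ fun f => ?_
    have hf : f ∈ IntermediateField.adjoin k {u, z} := by rw [hgen]; trivial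
    obtain ⟨a, ha, b, hb, hab⟩ := IntermediateField.mem_adjoin_iff_div.1 hf
    exact ⟨⟨a, ha⟩, ⟨b, hb⟩, hab⟩
  let φ : R →+* B := (R.val.toRingHom).codRestrict B.toSubring (fun f => hRB _ f.2)
  let m : Ideal R := (IsLocalRing.maximalIdeal B).comap φ
  have hm : m.IsPrime := Ideal.IsPrime.comap φ
  have hmem (f : R) : f ∈ m ↔ B.valuation (f : F) < 1 := B.valuation_lt_one_iff (φ f)
  let A : Subalgebra R F := Localization.subalgebra.ofField F m.primeCompl m.primeCompl_le_nonZeroDivisors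
  have : IsLocalization.AtPrime A m :=
    Localization.subalgebra.isLocalization_ofField F m.primeCompl m.primeCompl_le_nonZeroDivisors
  have : IsFractionRing A F := inferInstance
  have : IsLocalRing A := IsLocalization.AtPrime.isLocalRing A m
  have : IsNoetherianRing A := IsLocalization.isNoetherianRing m.primeCompl A inferInstance
  have hAmem (f : F) : f ∈ A ↔ ∃ (a s : R) (_ : s ∈ m.primeCompl),
      f = algebraMap R F a * (algebraMap R F s)⁻¹ := Iff.rfl
  -- Modulo u, an element of `m` is a polynomial in z, which ψ must divide; multiplying by g trades
  -- ψ(z) for u h.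
  have hmF (f : F) (hf : f ∈ R) (hfm : B.valuation f < 1) : ∃ f₁ ∈ R, g * f = u * f₁ := by
    obtain ⟨p, f₁, hf₁, hff⟩ := exists_sub_aeval_eq_mul_of_mem_adjoin hf
    have hp1 : B.valuation (aeval z p) < 1 := by
      have : aeval z p = f - u * f₁ := by rw [hff]; ring
      rw [this]
      refine B.valuation.map_sub_lt hfm ?_
      rw [map_mul]
      exact mul_lt_one_of_lt_of_le huB ((B.valuation_le_one_iff _).2 (hRB _ hf₁))
    obtain ⟨q, rfl⟩ := (val_aeval_lt_one_iff hkB' hzB hψ hψB p).1 hp1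
    refine ⟨h * aeval z q + g * f₁, add_mem (mul_mem hh (hp q)) (mul_mem hg hf₁), ?_⟩
    rw [hff, map_mul, mul_add, ← mul_assoc, hgh]; ring
  have hmax (a : A) : a ∈ IsLocalRing.maximalIdeal A ↔ ∃ b : A, a = algebraMap R A ⟨u, hu⟩ * b := by
    constructor
    · intro ha
      obtain ⟨f, s, rfl⟩ := IsLocalization.exists_mk'_eq m.primeCompl a
      rw [IsLocalization.AtPrime.mk'_mem_maximal_iff A m, hmem] at ha
      obtain ⟨f₁, hf₁, hgf⟩ := hmF f f.2 ha
      have hgs : (⟨g, hg⟩ * s : R) ∈ m.primeCompl := by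
        refine m.primeCompl.mul_mem ?_ s.2
        intro hgm
        exact absurd ((hmem _).1 hgm) (by simp [hgB])
      refine ⟨IsLocalization.mk' A ⟨f₁, hf₁⟩ (⟨_, hgs⟩ : m.primeCompl), ?_⟩
      rw [← IsLocalization.mk'_one (M := m.primeCompl) A, ← IsLocalization.mk'_mul]
      rw [IsLocalization.mk'_eq_iff_eq]
      congr 1
      apply Subtype.ext
      have e : ((1 : m.primeCompl) * ⟨_, hgs⟩ : m.primeCompl).1.1 = g * (s : R) := by simp
      simp only [MulMemClass.coe_mul] at e ⊢
      simp only [OneMemClass.coe_one, one_mul] at e ⊢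
      linear_combination (s : R).1 * hgf
    · rintro ⟨b, rfl⟩
      refine Ideal.mul_mem_right _ _ ?_
      rw [IsLocalization.AtPrime.to_map_mem_maximal_iff A m, hmem]
      exact huB
  set ϖ : A := algebraMap R A ⟨u, hu⟩ with hϖ
  have hϖu : algebraMap A F ϖ = u := rfl
  have hϖ0 : ϖ ≠ 0 := by
    intro h0; apply hu0; rw [← hϖu, h0, map_zero]
  have hspan : IsLocalRing.maximalIdeal A = Ideal.span {ϖ} := by
    ext a
    rw [hmax, Ideal.mem_span_singleton]; rfl
  have hnf : ¬ IsField A := by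
    rw [IsLocalRing.isField_iff_maximalIdeal_eq, hspan, Ideal.span_singleton_eq_bot]
    exact hϖ0
  -- A Noetherian local domain that is not a field and has a principal maximal ideal is a discrete
  -- valuation ring.
  have : IsDiscreteValuationRing A :=
    ((IsDiscreteValuationRing.TFAE A hnf).out 0 4).2
      (show Submodule.IsPrincipal (IsLocalRing.maximalIdeal A) from ⟨⟨ϖ, hspan⟩⟩)
  have hirr : Irreducible ϖ := (IsDiscreteValuationRing.irreducible_iff_uniformizer _).2 hspan
  -- every nonzero element is a unit times a power of `u`
  have hfac (f : F) (hf : f ≠ 0) : ∃ (n : ℤ) (a : Aˣ), f = algebraMap A F a * u ^ n := by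
    obtain ⟨a, b, hb, rfl⟩ := IsFractionRing.div_surjective (A := A) f
    have ha0 : a ≠ 0 := by rintro rfl; simp at hf
    have hb0 : b ≠ 0 := by rintro rfl; simp at hf
    obtain ⟨i, c, rfl⟩ := IsDiscreteValuationRing.eq_unit_mul_pow_irreducible ha0 hirr
    obtain ⟨j, d, rfl⟩ := IsDiscreteValuationRing.eq_unit_mul_pow_irreducible hb0 hirr
    refine ⟨i - j, c * d⁻¹, ?_⟩
    have hd : algebraMap A F (d : A) * algebraMap A F ((d⁻¹ : Aˣ) : A) = 1 := by
      rw [← map_mul, Units.mul_inv, map_one]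
    have hd0 : algebraMap A F (d : A) ≠ 0 := left_ne_zero_of_mul_eq_one hd
    rw [zpow_sub₀ hu0, Units.val_mul, map_mul, map_mul, map_mul, map_pow, map_pow, hϖu]
    rw [eq_inv_of_mul_eq_one_right hd]
    rw [zpow_natCast, zpow_natCast]
    field_simp
  -- places with the given zeros
  have hAP (P : Place k F) (h1 : P.val u < 1) (h2 : P.val z ≤ 1) (h3 : P.val (aeval z ψ) < 1)
      (a : A) : P.val (algebraMap A F a) ≤ 1 := by
    obtain ⟨f, s, hs, hfs⟩ := (hAmem a).1 a.2
    have e : algebraMap A F a = (f : F) * (s : F)⁻¹ := hfs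
    rw [e, map_mul, map_inv₀]
    have hf : P.val (f : F) ≤ 1 :=
      val_le_one_of_mem_adjoin P.val_algebraMap_le_one (by simp [h1.le, h2]) f.2
    -- Both `P` and `B` detect vanishing on k[u, z] by divisibility by ψ modulo u, so a denominator
    -- vanishing at `P` would lie in `m`.
    have hs1 : P.val (s : F) = 1 := by
      refine le_antisymm (val_le_one_of_mem_adjoin P.val_algebraMap_le_one
        (by simp [h1.le, h2]) s.2) (not_lt.1 fun hlt => hs ?_)
      obtain ⟨p, f₁, hf₁, hff⟩ := exists_sub_aeval_eq_mul_of_mem_adjoin s.2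
      have hp1 : P.val (aeval z p) < 1 := by
        have : aeval z p = s - u * f₁ := by rw [hff]; ring
        rw [this]
        refine P.val.map_sub_lt hlt ?_
        rw [map_mul]
        exact mul_lt_one_of_lt_of_le h1 (val_le_one_of_mem_adjoin P.val_algebraMap_le_one
          (by simp [h1.le, h2]) hf₁)
      have hd := (val_aeval_lt_one_iff P.val_algebraMap_le_one h2 hψ h3 p).1 hp1
      change s ∈ m
      rw [hmem, hff]
      refine B.valuation.map_add_lt ((val_aeval_lt_one_iff hkB' hzB hψ hψB p).2 hd) ?_
      rw [map_mul]
      exact mul_lt_one_of_lt_of_le huB ((B.valuation_le_one_iff _).2 (hRB _ hf₁))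
    rw [hs1]; simpa using hf
  have hpow (P : Place k F) (h1 : P.val u < 1) (h2 : P.val z ≤ 1) (h3 : P.val (aeval z ψ) < 1)
      (a : Aˣ) (n : ℤ) : P.val (algebraMap A F a * u ^ n) = P.val u ^ n := by
    have h : P.val (algebraMap A F (a : A)) * P.val (algebraMap A F ((a⁻¹ : Aˣ) : A)) = 1 := by
      rw [← map_mul, ← map_mul, Units.mul_inv, map_one, map_one]
    have : P.val (algebraMap A F (a : A)) = 1 := by
      refine le_antisymm (hAP P h1 h2 h3 _) ?_
      rw [← h]
      exact mul_le_of_le_one_right' (hAP P h1 h2 h3 _)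
    rw [map_mul, this, one_mul, map_zpow₀]
  have hval (P : Place k F) (h1 : P.val u < 1) (h2 : P.val z ≤ 1) (h3 : P.val (aeval z ψ) < 1) :
      P.val u = exp (-1) :=
    P.val_eq_exp_neg_one h1 fun f hf => by
      obtain ⟨n, a, rfl⟩ := hfac f hf
      exact ⟨n, hpow P h1 h2 h3 a n⟩
  let v : IsDedekindDomain.HeightOneSpectrum A :=
    { asIdeal := IsLocalRing.maximalIdeal A
      isPrime := inferInstance
      ne_bot := by rw [hspan, Ne, Ideal.span_singleton_eq_bot]; exact hϖ0 }
  have hvmem (f : F) (hf : f ∈ R) : v.valuation F f < 1 ↔ B.valuation f < 1 := by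
    have : f = algebraMap A F (algebraMap R A ⟨f, hf⟩) := rfl
    rw [this, v.valuation_lt_one_iff_mem]
    change _ ∈ IsLocalRing.maximalIdeal A ↔ _
    rw [IsLocalization.AtPrime.to_map_mem_maximal_iff A m, hmem]
    rfl
  have hvR (f : F) (hf : f ∈ R) : v.valuation F f ≤ 1 :=
    v.valuation_le_one (K := F) (algebraMap R A ⟨f, hf⟩)
  let P : Place k F :=
    { val := v.valuation F
      surjective := v.valuation_surjective F
      map_const := fun c hc => by
        refine le_antisymm (hvR _ (R.algebraMap_mem c)) (not_lt.1 fun hlt => ?_)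
        rw [hvmem _ (R.algebraMap_mem c)] at hlt
        have h1 : algebraMap k F c * algebraMap k F c⁻¹ = 1 := by
          rw [← map_mul, mul_inv_cancel₀ hc, map_one]
        have h2 := congrArg B.valuation h1
        rw [map_mul, map_one] at h2
        exact absurd h2 (mul_lt_one_of_lt_of_le hlt (hkB' _)).ne }
  have hP1 : P.val u < 1 := (hvmem u hu).2 huB
  have hP2 : P.val z ≤ 1 := hvR z hz
  have hP3 : P.val (aeval z ψ) < 1 := (hvmem _ (hp ψ)).2 hψB
  refine ⟨P, hval P hP1 hP2 hP3, hP2, hP3, ?_, ?_⟩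
  · intro f hf
    have hfA : f ∈ A := by
      rcases eq_or_ne f 0 with rfl | hf0
      · exact zero_mem A
      obtain ⟨n, a, rfl⟩ := hfac f hf0
      rw [hpow P hP1 hP2 hP3, hval P hP1 hP2 hP3, ← exp_zsmul, ← exp_zero, exp_le_exp,
        smul_eq_mul] at hf
      lift n to ℕ using by omega
      rw [zpow_natCast]
      exact mul_mem a.1.2 (pow_mem ϖ.2 n)
    obtain ⟨c, s, hs, rfl⟩ := (hAmem f).1 hfA
    change ∃ p : k[X], P.val ((c : F) * (s : F)⁻¹ - aeval z p) < 1
    obtain ⟨p, c₁, hc₁, hc⟩ := exists_sub_aeval_eq_mul_of_mem_adjoin c.2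
    obtain ⟨q, s₁, hs₁, hs'⟩ := exists_sub_aeval_eq_mul_of_mem_adjoin s.2
    have hus (x : F) (hx : x ∈ R) : P.val (u * x) < 1 := by
      rw [map_mul]; exact mul_lt_one_of_lt_of_le hP1 (hvR x hx)
    have hPs : P.val (s : F) = 1 := by
      refine le_antisymm (hvR _ s.2) (not_lt.1 fun hlt => hs ?_)
      change s ∈ m
      rw [hmem]
      exact (hvmem _ s.2).1 hlt
    have hs0 : (s : F) ≠ 0 := by intro h0; simp [h0] at hPs
    have hq : ¬ ψ ∣ q := by
      intro hd
      have := (val_aeval_lt_one_iff P.val_algebraMap_le_one hP2 hψ hP3 q).2 hd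
      have h2 := P.val.map_add_lt this (hus _ hs₁)
      rw [← hs'] at h2
      exact absurd hPs h2.ne
    obtain ⟨a, b, hab⟩ := (hψ.coprime_iff_not_dvd).2 hq
    -- `b` inverts `q` modulo ψ, so p b represents the residue of the fraction p(z)/q(z).
    refine ⟨p * b, ?_⟩
    have hab' := congrArg (aeval z) hab
    simp only [map_add, map_mul, map_one] at hab'
    have e : (c : F) * (s : F)⁻¹ - aeval z (p * b) =
        (u * (c₁ - s₁ * aeval z (p * b)) + aeval z ψ * aeval z (a * p)) * (s : F)⁻¹ := by
      rw [eq_mul_inv_iff_mul_eq₀ hs0, sub_mul, mul_assoc, inv_mul_cancel₀ hs0, hc, hs']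
      simp only [map_mul]
      linear_combination (-aeval z p) * hab'
    rw [e, map_mul, map_inv₀, hPs, inv_one, mul_one]
    refine P.val.map_add_lt (hus _ (sub_mem hc₁ (mul_mem hs₁ (hp _)))) ?_
    rw [map_mul]
    exact mul_lt_one_of_lt_of_le hP3 (hvR _ (hp _))
  -- Both places give a unit of `A` times u^n the value `exp (-n)`.
  · intro P' h1 h2 h3
    apply Place.ext
    ext f
    rcases eq_or_ne f 0 with rfl | hf0
    · simp
    obtain ⟨n, a, rfl⟩ := hfac f hf0
    rw [hpow P hP1 hP2 hP3, hpow P' h1 h2 h3, hval P hP1 hP2 hP3, hval P' h1 h2 h3]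

/-! ### Residue fields and relative degrees -/

namespace Place

section Residue

variable {k F : Type*} [Field k] [Field F] [Algebra k F] (P : Place k F)

/-- The inclusion of the constants into the valuation ring of a place. -/
def constHom : k →+* P.val.valuationSubring :=
  (algebraMap k F).codRestrict P.val.valuationSubring.toSubring fun c => P.val_algebraMap_le_one c

/-- The inclusion of the constants into the residue field of a place. -/
noncomputable def residueConstHom : k →+* IsLocalRing.ResidueField P.val.valuationSubring :=
  (IsLocalRing.residue P.val.valuationSubring).comp P.constHom

theorem residue_eq_zero_iff (a : P.val.valuationSubring) :
    IsLocalRing.residue P.val.valuationSubring a = 0 ↔ P.val (a : F) < 1 := by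
  have hu : IsUnit a ↔ P.val (a : F) = 1 :=
    (Valuation.integer.integers P.val).isUnit_iff_valuation_eq_one
  rw [IsLocalRing.residue_eq_zero_iff, IsLocalRing.mem_maximalIdeal, mem_nonunits_iff, hu]
  exact (lt_iff_le_and_ne.trans ⟨fun h => h.2, fun h => ⟨a.2, h⟩⟩).symm

theorem residue_eq_residue_iff (a b : P.val.valuationSubring) :
    IsLocalRing.residue P.val.valuationSubring a = IsLocalRing.residue P.val.valuationSubring b ↔
      P.val ((a : F) - b) < 1 := by
  rw [← sub_eq_zero, ← map_sub, residue_eq_zero_iff]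
  rfl

theorem coe_eval₂_constHom (z : P.val.valuationSubring) (p : k[X]) :
    ((eval₂ P.constHom z p : P.val.valuationSubring) : F) = aeval (z : F) p :=
  hom_eval₂ p P.constHom P.val.valuationSubring.subtype z

theorem eval₂_residueConstHom (z : P.val.valuationSubring) (p : k[X]) :
    eval₂ P.residueConstHom (IsLocalRing.residue _ z) p =
      IsLocalRing.residue P.val.valuationSubring (eval₂ P.constHom z p) :=
  (hom_eval₂ p P.constHom (IsLocalRing.residue _) z).symm

theorem residueConstHom_surjective (h : ∀ f, P.val f ≤ 1 → ∃ c : k, P.val (f - algebraMap k F c) < 1) :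
    Function.Surjective P.residueConstHom := by
  intro y
  obtain ⟨a, rfl⟩ := IsLocalRing.residue_surjective y
  obtain ⟨c, hc⟩ := h a a.2
  exact ⟨c, ((P.residue_eq_residue_iff a (P.constHom c)).2 hc).symm⟩

variable {z : F} {ψ : k[X]}

/-- The residue of z is a root of ψ, which defines the map; it is injective because k[X]/(ψ) is a
field, and `h` makes it surjective. -/
theorem exists_adjoinRoot_equiv_residueField (hψ : Irreducible ψ) (hz : P.val z ≤ 1)
    (hψz : P.val (aeval z ψ) < 1)
    (h : ∀ f, P.val f ≤ 1 → ∃ p : k[X], P.val (f - aeval z p) < 1) :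
    ∃ j : AdjoinRoot ψ ≃+* IsLocalRing.ResidueField P.val.valuationSubring,
      ∀ c : k, j (AdjoinRoot.of ψ c) = P.residueConstHom c := by
  have : Fact (Irreducible ψ) := ⟨hψ⟩
  let z' : P.val.valuationSubring := ⟨z, hz⟩
  have hroot : eval₂ P.residueConstHom (IsLocalRing.residue _ z') ψ = 0 := by
    rw [eval₂_residueConstHom, residue_eq_zero_iff, coe_eval₂_constHom]
    exact hψz
  let φ := AdjoinRoot.lift P.residueConstHom (IsLocalRing.residue _ z') hroot
  refine ⟨RingEquiv.ofBijective φ ⟨φ.injective, fun y => ?_⟩, fun c => AdjoinRoot.lift_of hroot⟩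
  obtain ⟨a, rfl⟩ := IsLocalRing.residue_surjective y
  obtain ⟨p, hp⟩ := h a a.2
  refine ⟨AdjoinRoot.mk ψ p, ?_⟩
  rw [AdjoinRoot.lift_mk, eval₂_residueConstHom, eq_comm, residue_eq_residue_iff,
    coe_eval₂_constHom]
  exact hp

theorem relativeDegree_eq_natDegree {K : Type*} [Field K] [Algebra k K] [Algebra K F]
    [IsScalarTower k K F] (Q : Place k K) (hPQ : P.LiesOver Q)
    (hQ : ∀ f, Q.val f ≤ 1 → ∃ c : k, Q.val (f - algebraMap k K c) < 1)
    (hψ : Irreducible ψ) (hz : P.val z ≤ 1) (hψz : P.val (aeval z ψ) < 1)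
    (h : ∀ f, P.val f ≤ 1 → ∃ p : k[X], P.val (f - aeval z p) < 1) :
    P.relativeDegree Q hPQ = ψ.natDegree := by
  obtain ⟨j, hj⟩ := P.exists_adjoinRoot_equiv_residueField hψ hz hψz h
  let i := RingEquiv.ofBijective Q.residueConstHom
    ⟨Q.residueConstHom.injective, Q.residueConstHom_surjective hQ⟩
  have hPQ' : Q.val.HasExtension P.val := hPQ
  have key : Module.finrank k (AdjoinRoot ψ) =
      Module.finrank (IsLocalRing.ResidueField Q.val.valuationSubring)
        (IsLocalRing.ResidueField P.val.valuationSubring) := by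
    refine Algebra.finrank_eq_of_equiv_equiv i j (RingHom.ext fun c => ?_)
    refine Eq.trans ?_ (hj c).symm
    refine (Valuation.HasExtension.algebraMap_residue_eq_residue_algebraMap Q.val P.val
      (Q.constHom c)).trans ?_
    refine congrArg (IsLocalRing.residue _) (Subtype.ext ?_)
    exact (IsScalarTower.algebraMap_apply k K F c).symm
  have hfin : Module.finrank k (AdjoinRoot ψ) = ψ.natDegree := by
    rw [(AdjoinRoot.powerBasis hψ.ne_zero).finrank, AdjoinRoot.powerBasis_dim]
  exact key.symm.trans hfin

end Residue

end Place

/-! ### The place t = ∞ of k(t) -/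

section Infinity

variable {k : Type*} [Field k]

open Classical in
theorem placeAtInfinity_val {f : RatFunc k} (hf : f ≠ 0) :
    (placeAtInfinity k).val f = exp f.intDegree :=
  RatFunc.inftyValuation_of_nonzero k hf

theorem placeAtInfinity_exists_const (f : RatFunc k) (hf : (placeAtInfinity k).val f ≤ 1) :
    ∃ c : k, (placeAtInfinity k).val (f - algebraMap k (RatFunc k) c) < 1 := by
  rcases eq_or_ne f 0 with rfl | hf0
  · exact ⟨0, by simp⟩
  rw [placeAtInfinity_val hf0, ← exp_zero, exp_le_exp, RatFunc.intDegree] at hf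
  set d := f.denom.natDegree with hd
  -- The value of f at infinity: the denominator is monic of degree `d`, and `c` is 0 when the
  -- numerator has smaller degree.
  set c := f.num.coeff d with hc
  refine ⟨c, ?_⟩
  rcases eq_or_ne (f - algebraMap k (RatFunc k) c) 0 with h0 | h0
  · rw [h0, map_zero]; exact zero_lt_one
  have hden : (algebraMap k[X] (RatFunc k) f.denom) ≠ 0 :=
    RatFunc.algebraMap_ne_zero f.denom_ne_zero
  have e : f - algebraMap k (RatFunc k) c =
      algebraMap k[X] (RatFunc k) (f.num - C c * f.denom) / algebraMap k[X] (RatFunc k) f.denom := by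
    rw [map_sub, map_mul, sub_div, mul_div_assoc, div_self hden, mul_one, RatFunc.num_div_denom,
      RatFunc.algebraMap_C, RatFunc.algebraMap_eq_C]
  have hp0 : f.num - C c * f.denom ≠ 0 := by
    intro hp; rw [hp, map_zero, zero_div] at e; exact h0 e
  have hdeg : (f.num - C c * f.denom).natDegree < d := by
    rw [natDegree_lt_iff_degree_lt hp0, degree_lt_iff_coeff_zero]
    intro m hm
    rcases hm.eq_or_lt with rfl | hm
    · have : f.denom.coeff d = 1 := f.monic_denom
      rw [coeff_sub, coeff_C_mul, this, mul_one, ← hc, sub_self]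
    · rw [coeff_sub, coeff_C_mul, coeff_eq_zero_of_natDegree_lt (n := m) (by omega),
        coeff_eq_zero_of_natDegree_lt (p := f.denom) (n := m) (by omega), mul_zero, sub_zero]
  rw [placeAtInfinity_val h0, ← exp_zero, exp_lt_exp, e,
    RatFunc.intDegree_div (RatFunc.algebraMap_ne_zero hp0) hden, RatFunc.intDegree_polynomial,
    RatFunc.intDegree_polynomial]
  omega

variable {F : Type*} [Field F] [Algebra k F] [Algebra (RatFunc k) F] [IsScalarTower k (RatFunc k) F]
  (P : Place k F)

namespace Place

/-- At a pole of X the leading term of a polynomial dominates, so only the degree is seen. Both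
lying over t = ∞ and the ramification index therefore depend on the value of X alone. -/
theorem val_algebraMap_ratFunc (h : 1 < P.val (algebraMap (RatFunc k) F RatFunc.X))
    {f : RatFunc k} (hf : f ≠ 0) : P.val (algebraMap (RatFunc k) F f) =
      P.val (algebraMap (RatFunc k) F RatFunc.X) ^ f.intDegree := by
  have : (P.val.comap (algebraMap (RatFunc k) F)).IsTrivialOn k := ⟨fun c hc => by
    rw [Valuation.comap_apply, ← IsScalarTower.algebraMap_apply]
    exact P.map_const c hc⟩
  exact RatFunc.valuation_eq_valuation_X_zpow_intDegree_of_one_lt_valuation_X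
    (v := P.val.comap (algebraMap (RatFunc k) F)) h hf

theorem liesOver_placeAtInfinity_iff :
    P.LiesOver (placeAtInfinity k) ↔ 1 < P.val (algebraMap (RatFunc k) F RatFunc.X) := by
  constructor
  · intro h
    have h' : (placeAtInfinity k).val.HasExtension P.val := h
    have := (Valuation.HasExtension.val_map_lt_iff (placeAtInfinity k).val P.val 1 RatFunc.X).2
    rw [map_one, map_one, map_one] at this
    refine this ?_
    rw [placeAtInfinity_val RatFunc.X_ne_zero, RatFunc.intDegree_X, ← exp_zero, exp_lt_exp]
    exact one_pos
  · intro h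
    refine ⟨Valuation.isEquiv_iff_val_le_one.2 fun {f} => ?_⟩
    rcases eq_or_ne f 0 with rfl | hf
    · simp
    · rw [Valuation.comap_apply, P.val_algebraMap_ratFunc h hf, placeAtInfinity_val hf,
        ← exp_zero, exp_le_exp]
      exact (zpow_le_one_iff_right₀ h).symm

theorem isRamificationIndex_placeAtInfinity {e : ℕ}
    (he : 0 < e) (h : P.val (algebraMap (RatFunc k) F RatFunc.X) = exp (e : ℤ)) :
    P.IsRamificationIndex (placeAtInfinity k) e := by
  intro f hf
  have h1 : 1 < P.val (algebraMap (RatFunc k) F RatFunc.X) := by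
    rw [h, ← exp_zero, exp_lt_exp]; exact_mod_cast he
  rw [ord, ord, P.val_algebraMap_ratFunc h1 hf, placeAtInfinity_val hf, h, ← exp_zsmul, log_exp,
    log_exp, smul_eq_mul]
  ring

theorem liesOverWith_placeAtInfinity {e : ℕ} (he : 0 < e)
    (h : P.val (algebraMap (RatFunc k) F RatFunc.X) = exp (e : ℤ)) {z : F} {ψ : k[X]}
    (hψ : Irreducible ψ) (hz : P.val z ≤ 1) (hψz : P.val (aeval z ψ) < 1)
    (hres : ∀ f, P.val f ≤ 1 → ∃ p : k[X], P.val (f - aeval z p) < 1) :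
    P.LiesOverWith (placeAtInfinity k) e ψ.natDegree := by
  have h1 : 1 < P.val (algebraMap (RatFunc k) F RatFunc.X) := by
    rw [h, ← exp_zero, exp_lt_exp]; exact_mod_cast he
  have hl := P.liesOver_placeAtInfinity_iff.2 h1
  exact ⟨hl, P.isRamificationIndex_placeAtInfinity he h,
    P.relativeDegree_eq_natDegree _ hl placeAtInfinity_exists_const hψ hz hψz hres⟩

end Place

end Infinity

/-! ### The curve equation in the three charts -/

section CurveValuation

variable {F Γ : Type*} [Field F] [LinearOrderedCommGroupWithZero Γ] (w : Valuation F Γ)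
  {x t : F} {N : ℕ}

/-- The relation ψ(z) = u h for u = 1/t, z = x t^(2N+4) and g = 1, using x = u^(2N+4) z to extract
the factor u. -/
theorem firstChart_identity (ht0 : t ≠ 0)
    (hE : (x ^ (N + 2) + 1) ^ 2 = x * (x - 1) * (x - t ^ (2 * N + 4))) :
    x * t ^ (2 * N + 4) - 1 = t⁻¹ * (t⁻¹ ^ (2 * N + 3) * (x * t ^ (2 * N + 4)) *
      (x * t ^ (2 * N + 4) + 2 * x ^ (N + 1) + x ^ (2 * N + 3) - x * (x - 1))) := by
  have h : t⁻¹ * (t⁻¹ ^ (2 * N + 3) * (x * t ^ (2 * N + 4))) = x := by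
    rw [inv_pow]; field_simp; ring
  rw [mul_assoc (t⁻¹ ^ (2 * N + 3)), ← mul_assoc t⁻¹, ← mul_assoc (t⁻¹ * _), mul_assoc t⁻¹, h]
  ring_nf at hE ⊢
  linear_combination -hE

/-- The curve equation times -t^(-(2N+4)); here g = x(1 - x t^(-(2N+4))) and z = x. -/
theorem secondChart_identity (ht0 : t ≠ 0)
    (hE : (x ^ (N + 2) + 1) ^ 2 = x * (x - 1) * (x - t ^ (2 * N + 4))) :
    x * (1 - x * t⁻¹ ^ (2 * N + 4)) * (x - 1) =
      t⁻¹ * (-(t⁻¹ ^ (2 * N + 3) * (x ^ (N + 2) + 1) ^ 2)) := by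
  rw [hE, mul_neg, ← mul_assoc, ← pow_succ']
  have : t⁻¹ ^ (2 * N + 4) * t ^ (2 * N + 4) = 1 := by
    rw [← mul_pow, inv_mul_cancel₀ ht0, one_pow]
  linear_combination (-x * (x - 1)) * this

/-- The curve equation divided by x² t^(2N+4), the common size of the two dominant terms on this
segment up to the unit z². -/
theorem thirdChart_identity {z : F} (hx0 : x ≠ 0) (ht0 : t ≠ 0)
    (hz : z = t⁻¹ ^ (N + 2) * x ^ (N + 1))
    (hE : (x ^ (N + 2) + 1) ^ 2 = x * (x - 1) * (x - t ^ (2 * N + 4))) :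
    z ^ 2 + 1 = x⁻¹ * (1 - z ^ 2 *
      (2 * x⁻¹ ^ (N + 1) + x⁻¹ ^ (2 * N + 3) - x⁻¹ ^ (2 * N) + x⁻¹ ^ (2 * N + 1))) := by
  have h1 : t⁻¹ ^ (N + 2) * t ^ (N + 2) = 1 := by rw [← mul_pow, inv_mul_cancel₀ ht0, one_pow]
  have h2 : x⁻¹ ^ N * x ^ N = 1 := by rw [← mul_pow, inv_mul_cancel₀ hx0, one_pow]
  have h3 : x⁻¹ * x = 1 := inv_mul_cancel₀ hx0
  subst hz
  have hE' : (x ^ N * x ^ 2 + 1) ^ 2 = x * (x - 1) * (x - (t ^ (N + 2)) ^ 2) := by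
    linear_combination hE
  generalize t ^ (N + 2) = T at *
  generalize t⁻¹ ^ (N + 2) = S at *
  rw [pow_succ x N, pow_succ x⁻¹ N, pow_succ x⁻¹ (2 * N), pow_add x⁻¹ (2 * N) 3, pow_mul']
  have hS : S = T⁻¹ := eq_inv_of_mul_eq_one_left h1
  have hT : T ≠ 0 := right_ne_zero_of_mul_eq_one h1
  have hA0 : x ^ N ≠ 0 := pow_ne_zero _ hx0
  have hA : x⁻¹ ^ N = (x ^ N)⁻¹ := inv_pow x N
  rw [hS, hA]
  generalize x ^ N = A at *
  field_simp
  linear_combination hE'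

theorem one_lt_val_of_mul_pow_eq_one {a : F} {n : ℕ} (ha : w a < 1) (h : w (a * t ^ n) = 1) :
    1 < w t := by
  by_contra! ht
  rw [map_mul, map_pow] at h
  exact absurd h (mul_lt_one_of_lt_of_le ha (pow_le_one' ht n)).ne

theorem val_inv_lt_one (h : 1 < w t) : w t⁻¹ < 1 := by
  rw [map_inv₀]; exact inv_lt_one_of_one_lt₀ h

theorem val_eq_one_of_sub_lt_one {a b : F} (hb : w b = 1) (h : w (a - b) < 1) : w a = 1 := by
  rw [← hb] at h ⊢
  exact w.map_eq_of_sub_lt h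

theorem val_firstChart (hE : (x ^ (N + 2) + 1) ^ 2 = x * (x - 1) * (x - t ^ (2 * N + 4)))
    (hx : w x < 1) :
    w (x * t ^ (2 * N + 4)) = 1 ∧ w (x * t ^ (2 * N + 4) - 1) < 1 ∧ w t⁻¹ < 1 := by
  set z := x * t ^ (2 * N + 4) with hz
  have hxO : x ∈ w.integer := hx.le
  -- As 1 - x is a unit, the equation can be solved for z: it is integral, and then z - 1 is
  -- divisible by x.
  have h1 : w (1 - x) = 1 := val_eq_one_of_sub_lt_one w (map_one w) (by
    rw [sub_sub_cancel_left, Valuation.map_neg]; exact hx)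
  have h2 : z * (1 - x) = (x ^ (N + 2) + 1) ^ 2 - x ^ 2 * (x - 1) := by
    rw [hz]; linear_combination -hE
  have hzO : z ∈ w.integer := by
    have : z * (1 - x) ∈ w.integer := by
      rw [h2]
      exact sub_mem (pow_mem (add_mem (pow_mem hxO _) (one_mem _)) _)
        (mul_mem (pow_mem hxO _) (sub_mem hxO (one_mem _)))
    rw [Valuation.mem_integer_iff, map_mul, h1, mul_one] at this
    exact this
  have h3 : z - 1 = x * (z + (2 : ℕ) * x ^ (N + 1) + x ^ (2 * N + 3) - x * (x - 1)) := by
    push_cast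
    linear_combination h2
  have h4 : w (z - 1) < 1 := by
    rw [h3, map_mul]
    exact mul_lt_one_of_lt_of_le hx (sub_mem (add_mem (add_mem hzO
      (mul_mem (natCast_mem w.integer 2) (pow_mem hxO _))) (pow_mem hxO _))
      (mul_mem hxO (sub_mem hxO (one_mem _))))
  have h5 : w z = 1 := val_eq_one_of_sub_lt_one w (map_one w) h4
  exact ⟨h5, h4, val_inv_lt_one w (one_lt_val_of_mul_pow_eq_one w hx h5)⟩

/-- At x = 1 the left side of the equation is 4, a unit by `hw2`; so t must have a pole to balance
the zero of x - 1. -/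
theorem val_secondChart (hE : (x ^ (N + 2) + 1) ^ 2 = x * (x - 1) * (x - t ^ (2 * N + 4)))
    (hw2 : w 2 = 1) (hx : w (x - 1) < 1) : w x = 1 ∧ w t⁻¹ < 1 := by
  have h1 : w x = 1 := val_eq_one_of_sub_lt_one w (map_one w) hx
  have hxO : x ∈ w.integer := h1.le
  have h2 : w (x ^ (N + 2) + 1) = 1 := by
    refine val_eq_one_of_sub_lt_one w hw2 ?_
    have : x ^ (N + 2) + 1 - 2 = (x - 1) * ∑ i ∈ Finset.range (N + 2), x ^ i := by
      rw [mul_geom_sum]; ring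
    rw [this, map_mul]
    exact mul_lt_one_of_lt_of_le hx (sum_mem fun i _ => pow_mem hxO i)
  have h3 : w (x * (x - 1) * t ^ (2 * N + 4)) = 1 := by
    have : x * (x - 1) * t ^ (2 * N + 4) = x ^ 2 * (x - 1) - (x ^ (N + 2) + 1) ^ 2 := by
      linear_combination hE
    rw [this]
    refine val_eq_one_of_sub_lt_one w (b := -(x ^ (N + 2) + 1) ^ 2) ?_ ?_
    · rw [Valuation.map_neg, map_pow, h2, one_pow]
    · rw [sub_neg_eq_add, sub_add_cancel, map_mul, map_pow, h1, one_pow, one_mul]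
      exact hx
  refine ⟨h1, val_inv_lt_one w (one_lt_val_of_mul_pow_eq_one w (a := x * (x - 1)) ?_ h3)⟩
  rw [map_mul, h1, one_mul]
  exact hx

/-- The equation makes x(x - 1)t^(2N+4) integral, which is impossible if x and x - 1 are units and t
has a pole. -/
theorem val_sub_one_lt_one (hE : (x ^ (N + 2) + 1) ^ 2 = x * (x - 1) * (x - t ^ (2 * N + 4)))
    (ht : 1 < w t) (hx : w x = 1) : w (x - 1) < 1 := by
  have hxO : x ∈ w.integer := hx.le
  have h3 : w (x * (x - 1) * t ^ (2 * N + 4)) ≤ 1 := by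
    have : x * (x - 1) * t ^ (2 * N + 4) = x ^ 2 * (x - 1) - (x ^ (N + 2) + 1) ^ 2 := by
      linear_combination hE
    rw [this]
    exact sub_mem (mul_mem (pow_mem hxO _) (sub_mem hxO (one_mem _)))
      (pow_mem (add_mem (pow_mem hxO _) (one_mem _)) _)
  by_contra! h
  rw [map_mul, map_mul, map_pow, hx, one_mul] at h3
  refine absurd h3 (not_le.2 ?_)
  exact lt_of_lt_of_le (one_lt_pow₀ ht (by omega)) (le_mul_of_one_le_left' h)

theorem val_thirdChart {z : F} (hz : z = t⁻¹ ^ (N + 2) * x ^ (N + 1)) (ht0 : t ≠ 0)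
    (hE : (x ^ (N + 2) + 1) ^ 2 = x * (x - 1) * (x - t ^ (2 * N + 4))) (hx : 1 < w x) :
    w z = 1 ∧ w (z ^ 2 + 1) < 1 ∧ w (t / x) < 1 := by
  have hx0 : x ≠ 0 := by rintro rfl; simp at hx
  have hy : w x⁻¹ < 1 := val_inv_lt_one w hx
  have hid := thirdChart_identity hx0 ht0 hz hE
  set y := x⁻¹ with hydef
  have hyO : y ∈ w.integer := hy.le
  set s := (2 : ℕ) * y ^ (N + 1) + y ^ (2 * N + 3) - y ^ (2 * N) + y ^ (2 * N + 1) with hs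
  have hsO : s ∈ w.integer := add_mem (sub_mem (add_mem
    (mul_mem (natCast_mem w.integer 2) (pow_mem hyO _)) (pow_mem hyO _)) (pow_mem hyO _))
    (pow_mem hyO _)
  have hid' : z ^ 2 + 1 = y * (1 - z ^ 2 * s) := by rw [hid, hs]; push_cast; ring
  have h1 : w (1 + y * s) = 1 := val_eq_one_of_sub_lt_one w (map_one w) (by
    rw [add_sub_cancel_left, map_mul]; exact mul_lt_one_of_lt_of_le hy hsO)
  have h2 : w (y - 1) = 1 := val_eq_one_of_sub_lt_one w (b := -1) (by simp) (by simpa using hy)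
  have h3 : w z = 1 := by
    -- Both 1 + ys and y - 1 are units because y vanishes, so z is a unit too.
    have h4 : z ^ 2 * (1 + y * s) = y - 1 := by linear_combination hid'
    have h5 := congrArg w h4
    rw [map_mul, h1, mul_one, map_pow, h2] at h5
    exact (pow_eq_one_iff_of_nonneg zero_le two_ne_zero).1 h5
  have hzO : z ∈ w.integer := h3.le
  refine ⟨h3, ?_, ?_⟩
  · rw [hid', map_mul]
    exact mul_lt_one_of_lt_of_le hy (sub_mem (one_mem _) (mul_mem (pow_mem hzO _) hsO))
  · have h6 : (t / x) ^ (N + 2) * z = y := by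
      rw [hz, hydef, div_pow, inv_pow]; field_simp; ring
    have h7 := congrArg w h6
    rw [map_mul, h3, mul_one, map_pow] at h7
    by_contra! h
    exact absurd h7 (lt_of_lt_of_le hy (one_le_pow_of_one_le' h _)).ne'

end CurveValuation

/-- Chevalley's theorem applied to the ideal (y) of k[y]. It is proper: 1 = y p(y) would make y a
root of Xp - 1, whose constant term is -1. -/
theorem exists_valuationSubring_val_lt_one {k F : Type*} [Field k] [Field F] [Algebra k F] {y : F}
    (hy : Transcendental k y) : ∃ B : ValuationSubring F,
      (∀ c : k, B.valuation (algebraMap k F c) ≤ 1) ∧ B.valuation y < 1 := by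
  let A := Algebra.adjoin k {y}
  have hyA : y ∈ A.toSubring := Algebra.subset_adjoin rfl
  obtain ⟨B, hAB, hB⟩ := Ideal.image_subset_nonunits_valuationSubring (A := A.toSubring)
    (Ideal.span {⟨y, hyA⟩}) (by
      rw [Ne, Ideal.eq_top_iff_one, Ideal.mem_span_singleton]
      rintro ⟨a, ha⟩
      have haA : (a : F) ∈ Algebra.adjoin k {y} := a.2
      rw [Algebra.adjoin_singleton_eq_range_aeval] at haA
      obtain ⟨p, hp⟩ := haA
      have h1 : (1 : F) = y * aeval y p := by
        refine (congrArg Subtype.val ha).trans ?_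
        exact congrArg (y * ·) hp.symm
      have h2 : aeval y (X * p - 1) = 0 := by simp [← h1]
      have h3 := (transcendental_iff.1 hy) _ h2
      have h4 := congrArg (eval 0) h3
      simp at h4)
  refine ⟨B, fun c => (B.valuation_le_one_iff _).2 (hAB (A.algebraMap_mem c)), ?_⟩
  exact B.mem_nonunits_iff.1 (hB ⟨_, Ideal.subset_span rfl, rfl⟩)

theorem val_algebraMap_eq_one {k F Γ : Type*} [Field k] [Field F] [Algebra k F]
    [LinearOrderedCommGroupWithZero Γ] {w : Valuation F Γ}
    (hk : ∀ c : k, w (algebraMap k F c) ≤ 1) {c : k} (hc : c ≠ 0) :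
    w (algebraMap k F c) = 1 := by
  refine le_antisymm (hk c) ?_
  have h : w (algebraMap k F c) * w (algebraMap k F c⁻¹) = 1 := by
    rw [← map_mul, ← map_mul, mul_inv_cancel₀ hc, map_one, map_one]
  rw [← h]
  exact mul_le_of_le_one_right' (hk _)

theorem adjoin_pair_eq_top {k F : Type*} [Field k] [Field F] [Algebra k F] {x t u z : F}
    (hgen : IntermediateField.adjoin k {x, t} = ⊤) (hx : x ∈ IntermediateField.adjoin k {u, z})
    (ht : t ∈ IntermediateField.adjoin k {u, z}) : IntermediateField.adjoin k {u, z} = ⊤ := by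
  rw [eq_top_iff, ← hgen, IntermediateField.adjoin_le_iff]
  rintro y (rfl | rfl)
  exacts [hx, ht]

theorem irreducible_X_sub_one (k : Type*) [Field k] : Irreducible (X - 1 : k[X]) := by
  rw [← C_1]; exact irreducible_X_sub_C 1

/-! ### Construction of the places -/

section Places

variable {k F : Type*} [Field k] [Field F] [Algebra k F] {x t : F} {N : ℕ}

theorem exists_firstPlace (hgen : IntermediateField.adjoin k {x, t} = ⊤)
    (hx : Transcendental k x) (ht0 : t ≠ 0)
    (hE : (x ^ (N + 2) + 1) ^ 2 = x * (x - 1) * (x - t ^ (2 * N + 4))) :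
    ∃ P : Place k F, P.val t = exp 1 ∧ P.val x = exp (-(2 * N + 4) : ℤ) ∧
      P.val (x * t ^ (2 * N + 4)) ≤ 1 ∧ P.val (aeval (x * t ^ (2 * N + 4)) (X - 1 : k[X])) < 1 ∧
      (∀ f, P.val f ≤ 1 → ∃ p : k[X], P.val (f - aeval (x * t ^ (2 * N + 4)) p) < 1) ∧
      ∀ P' : Place k F, P'.val x < 1 → P' = P := by
  set z := x * t ^ (2 * N + 4) with hz
  set u := t⁻¹ with hu
  have hu0 : u ≠ 0 := inv_ne_zero ht0
  have hxu : x = u ^ (2 * N + 4) * z := by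
    rw [hz, hu, inv_pow]; field_simp
  have haz : aeval z (X - 1 : k[X]) = z - 1 := by simp
  obtain ⟨B, hBk, hBx⟩ := exists_valuationSubring_val_lt_one hx
  obtain ⟨h1, h2, h3⟩ := val_firstChart B.valuation hE hBx
  have huR : u ∈ Algebra.adjoin k {u, z} := Algebra.subset_adjoin (by simp)
  have hzR : z ∈ Algebra.adjoin k {u, z} := Algebra.subset_adjoin (by simp)
  have hxR : x ∈ Algebra.adjoin k {u, z} := by
    have := mul_mem (pow_mem huR (2 * N + 4)) hzR
    rwa [← hxu] at this
  have huL : u ∈ IntermediateField.adjoin k {u, z} := IntermediateField.subset_adjoin _ _ (by simp)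
  have hgen' : IntermediateField.adjoin k {u, z} = ⊤ := by
    refine adjoin_pair_eq_top hgen (IntermediateField.algebra_adjoin_le_adjoin _ _ hxR) ?_
    have := inv_mem huL
    rwa [hu, inv_inv] at this
  obtain ⟨P, hPu, hPz, hPψ, hres, huniq⟩ := exists_place hgen' hu0 (irreducible_X_sub_one k)
    B.valuation hBk h3 h1.le (by rwa [haz]) (one_mem _) (map_one _)
    (h := u ^ (2 * N + 3) * z * (z + 2 * x ^ (N + 1) + x ^ (2 * N + 3) - x * (x - 1)))
    (mul_mem (mul_mem (pow_mem huR _) hzR) (sub_mem (add_mem (add_mem hzR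
      (mul_mem (ofNat_mem _ 2) (pow_mem hxR _))) (pow_mem hxR _))
      (mul_mem hxR (sub_mem hxR (one_mem _)))))
    (by rw [haz, one_mul]; exact firstChart_identity ht0 hE)
  refine ⟨P, ?_, ?_, hPz, hPψ, hres, fun P' hP' => ?_⟩
  · rw [hu, map_inv₀, inv_eq_iff_eq_inv, ← exp_neg, neg_neg] at hPu
    exact hPu
  · have hz1 : P.val z = 1 := val_eq_one_of_sub_lt_one P.val (map_one _) (by rwa [haz] at hPψ)
    rw [hxu, map_mul, map_pow, hPu, hz1, mul_one, ← exp_nsmul, exp_inj]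
    simp
  · obtain ⟨h1, h2, h3⟩ := val_firstChart P'.val hE hP'
    exact huniq P' h3 h1.le (by rwa [haz])

theorem exists_secondPlace (hgen : IntermediateField.adjoin k {x, t} = ⊤)
    (hx : Transcendental k x) (ht0 : t ≠ 0) (h2 : (2 : k) ≠ 0)
    (hE : (x ^ (N + 2) + 1) ^ 2 = x * (x - 1) * (x - t ^ (2 * N + 4))) :
    ∃ P : Place k F, P.val t = exp 1 ∧ P.val x = 1 ∧ P.val (aeval x (X - 1 : k[X])) < 1 ∧
      (∀ f, P.val f ≤ 1 → ∃ p : k[X], P.val (f - aeval x p) < 1) ∧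
      ∀ P' : Place k F, 1 < P'.val t → P'.val x = 1 → P' = P := by
  set u := t⁻¹ with hu
  have hu0 : u ≠ 0 := inv_ne_zero ht0
  have haz : aeval x (X - 1 : k[X]) = x - 1 := by simp
  have hx1 : Transcendental k (x - 1) := by
    intro h
    refine hx ?_
    have := h.add (isAlgebraic_one (R := k) (A := F))
    rwa [sub_add_cancel] at this
  obtain ⟨B, hBk, hBx⟩ := exists_valuationSubring_val_lt_one hx1
  have hB2 : B.valuation 2 = 1 := by
    have := val_algebraMap_eq_one hBk h2
    rwa [map_ofNat] at this
  obtain ⟨hB1, hBu⟩ := val_secondChart B.valuation hE hB2 hBx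
  have huR : u ∈ Algebra.adjoin k {u, x} := Algebra.subset_adjoin (by simp)
  have hxR : x ∈ Algebra.adjoin k {u, x} := Algebra.subset_adjoin (by simp)
  have huL : u ∈ IntermediateField.adjoin k {u, x} := IntermediateField.subset_adjoin _ _ (by simp)
  have hgen' : IntermediateField.adjoin k {u, x} = ⊤ := by
    refine adjoin_pair_eq_top hgen (IntermediateField.algebra_adjoin_le_adjoin _ _ hxR) ?_
    have := inv_mem huL
    rwa [hu, inv_inv] at this
  have hBg : B.valuation (x * (1 - x * u ^ (2 * N + 4))) = 1 := by
    rw [map_mul, hB1, one_mul]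
    refine val_eq_one_of_sub_lt_one _ (map_one _) ?_
    rw [sub_sub_cancel_left, Valuation.map_neg, map_mul, hB1, one_mul, map_pow]
    exact pow_lt_one₀ zero_le hBu (by omega)
  obtain ⟨P, hPu, hPz, hPψ, hres, huniq⟩ := exists_place hgen' hu0 (irreducible_X_sub_one k)
    B.valuation hBk hBu hB1.le (by rwa [haz]) (g := x * (1 - x * u ^ (2 * N + 4)))
    (mul_mem hxR (sub_mem (one_mem _) (mul_mem hxR (pow_mem huR _)))) hBg
    (h := -(u ^ (2 * N + 3) * (x ^ (N + 2) + 1) ^ 2))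
    (neg_mem (mul_mem (pow_mem huR _) (pow_mem (add_mem (pow_mem hxR _) (one_mem _)) _)))
    (by rw [haz]; exact secondChart_identity ht0 hE)
  refine ⟨P, ?_, ?_, hPψ, hres, fun P' ht' hx' => ?_⟩
  · rw [hu, map_inv₀, inv_eq_iff_eq_inv, ← exp_neg, neg_neg] at hPu
    exact hPu
  · exact val_eq_one_of_sub_lt_one P.val (map_one _) (by rwa [haz] at hPψ)
  · refine huniq P' (val_inv_lt_one _ ht') hx'.le ?_
    rw [haz]
    exact val_sub_one_lt_one P'.val hE ht' hx'

/-- A general factor ψ of X² + 1 covers both cases of the theorem; `hwg` says that the cofactor does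
not vanish at the point. The values come from x⁻¹ = u^(N+2) z and t = u x, where u has valuation 1.
-/
theorem exists_thirdPlace {Γ : Type*} [LinearOrderedCommGroupWithZero Γ]
    (hgen : IntermediateField.adjoin k {x, t} = ⊤) (hx0 : x ≠ 0) (ht0 : t ≠ 0)
    (hE : (x ^ (N + 2) + 1) ^ 2 = x * (x - 1) * (x - t ^ (2 * N + 4)))
    {z : F} (hz : z = t⁻¹ ^ (N + 2) * x ^ (N + 1)) {ψ g : k[X]} (hψ : Irreducible ψ)
    (hgψ : g * ψ = X ^ 2 + 1) (w : Valuation F Γ) (hwk : ∀ c : k, w (algebraMap k F c) ≤ 1)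
    (hwx : 1 < w x) (hwψ : w (aeval z ψ) < 1) (hwg : w (aeval z g) = 1) :
    ∃ P : Place k F, P.val t = exp (N + 1 : ℤ) ∧ P.val x = exp (N + 2 : ℤ) ∧
      P.val z ≤ 1 ∧ P.val (aeval z ψ) < 1 ∧
      (∀ f, P.val f ≤ 1 → ∃ p : k[X], P.val (f - aeval z p) < 1) ∧
      ∀ P' : Place k F, 1 < P'.val x → P'.val (aeval z ψ) < 1 → P' = P := by
  set u := t / x with hu
  have hu0 : u ≠ 0 := div_ne_zero ht0 hx0
  have hz0 : z ≠ 0 := by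
    rw [hz]; exact mul_ne_zero (pow_ne_zero _ (inv_ne_zero ht0)) (pow_ne_zero _ hx0)
  have hxu : x⁻¹ = u ^ (N + 2) * z := by
    rw [hz, hu, div_pow, inv_pow]; field_simp; ring
  obtain ⟨h1, -, h3⟩ := val_thirdChart w hz ht0 hE hwx
  have huR : u ∈ Algebra.adjoin k {u, z} := Algebra.subset_adjoin (by simp)
  have hzR : z ∈ Algebra.adjoin k {u, z} := Algebra.subset_adjoin (by simp)
  have hxR : x⁻¹ ∈ Algebra.adjoin k {u, z} := by
    rw [hxu]; exact mul_mem (pow_mem huR _) hzR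
  have hxL : x ∈ IntermediateField.adjoin k {u, z} := by
    have h : x⁻¹ ∈ IntermediateField.adjoin k {u, z} :=
      IntermediateField.algebra_adjoin_le_adjoin _ _ hxR
    have := inv_mem h
    rwa [inv_inv] at this
  have hgen' : IntermediateField.adjoin k {u, z} = ⊤ := by
    refine adjoin_pair_eq_top hgen hxL ?_
    have := mul_mem (IntermediateField.algebra_adjoin_le_adjoin _ _ huR) hxL
    rwa [hu, div_mul_cancel₀ _ hx0] at this
  have hgz : aeval z g * aeval z ψ = z ^ 2 + 1 := by
    rw [← map_mul, hgψ]; simp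
  obtain ⟨P, hPu, hPz, hPψ, hres, huniq⟩ := exists_place hgen' hu0 hψ
    w hwk h3 h1.le hwψ (g := aeval z g)
    (Algebra.adjoin_mono (by simp) (aeval_mem_adjoin_singleton k z)) hwg
    (h := u ^ (N + 1) * z * (1 - z ^ 2 *
      (2 * x⁻¹ ^ (N + 1) + x⁻¹ ^ (2 * N + 3) - x⁻¹ ^ (2 * N) + x⁻¹ ^ (2 * N + 1))))
    (mul_mem (mul_mem (pow_mem huR _) hzR) (sub_mem (one_mem _) (mul_mem (pow_mem hzR _)
      (add_mem (sub_mem (add_mem (mul_mem (ofNat_mem _ 2) (pow_mem hxR _)) (pow_mem hxR _))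
        (pow_mem hxR _)) (pow_mem hxR _)))))
    (by
      rw [hgz, thirdChart_identity hx0 ht0 hz hE, ← mul_assoc u, ← mul_assoc u, ← pow_succ',
        ← hxu])
  have hPz1 : P.val z = 1 := by
    have h4 : P.val (z ^ 2 + 1) < 1 := by
      rw [← hgz, map_mul, mul_comm]
      exact mul_lt_one_of_lt_of_le hPψ (val_aeval_le_one P.val_algebraMap_le_one hPz g)
    have h5 : P.val (z ^ 2) = 1 :=
      val_eq_one_of_sub_lt_one P.val (b := -1) (by simp) (by simpa using h4)
    rw [map_pow] at h5
    exact (pow_eq_one_iff_of_nonneg zero_le two_ne_zero).1 h5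
  have hPx : P.val x = exp (N + 2 : ℤ) := by
    have := congrArg P.val hxu
    rw [map_inv₀, map_mul, map_pow, hPu, hPz1, mul_one, ← exp_nsmul, inv_eq_iff_eq_inv,
      ← exp_neg] at this
    rw [this, exp_inj]; simp
  refine ⟨P, ?_, hPx, hPz, hPψ, hres, fun P' hx' hψ' => ?_⟩
  · have : t = u * x := by rw [hu, div_mul_cancel₀ _ hx0]
    rw [this, map_mul, hPu, hPx, ← exp_add, exp_inj]; ring
  · obtain ⟨h1, -, h3⟩ := val_thirdChart P'.val hz ht0 hE hx'
    exact huniq P' h3 h1.le hψ'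

end Places

/-! ### The function field and the scaling of t -/

section FunctionField

variable {k : Type*} [Field k] {N : ℕ}

theorem mk_Y_eq : (Ideal.Quotient.mk (curveIdeal k (2 * N + 3)) (MvPolynomial.X 1)) =
    Ideal.Quotient.mk (curveIdeal k (2 * N + 3)) (MvPolynomial.X 0) ^ (N + 2) + 1 := by
  rw [← map_pow, ← map_one (Ideal.Quotient.mk (curveIdeal k (2 * N + 3))), ← map_add,
    Ideal.Quotient.eq]
  have : (2 * N + 3 + 1) / 2 = N + 2 := by omega
  refine Ideal.subset_span ?_
  rw [this]
  simp

theorem coordRing_equation :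
    ((Ideal.Quotient.mk (curveIdeal k (2 * N + 3)) (MvPolynomial.X 0)) ^ (N + 2) + 1) ^ 2 =
    Ideal.Quotient.mk (curveIdeal k (2 * N + 3)) (MvPolynomial.X 0) *
      (Ideal.Quotient.mk (curveIdeal k (2 * N + 3)) (MvPolynomial.X 0) - 1) *
      (Ideal.Quotient.mk (curveIdeal k (2 * N + 3)) (MvPolynomial.X 0) -
        Ideal.Quotient.mk (curveIdeal k (2 * N + 3)) (MvPolynomial.X 2) ^ (2 * N + 4)) := by
  rw [← mk_Y_eq]
  have h : (MvPolynomial.X 1 ^ 2 - (MvPolynomial.X 0 ^ 3 -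
      MvPolynomial.X 0 ^ 2 * (MvPolynomial.X 2 ^ (2 * N + 3 + 1) + 1) +
      MvPolynomial.X 0 * MvPolynomial.X 2 ^ (2 * N + 3 + 1)) : MvPolynomial (Fin 3) k) ∈
      curveIdeal k (2 * N + 3) := Ideal.subset_span (by simp)
  have h' := Ideal.Quotient.eq_zero_iff_mem.2 h
  simp only [map_sub, map_add, map_mul, map_pow, map_one] at h'
  linear_combination h'

/-- The equations involve t only through t^(2N+4), which scaling by `c` preserves. -/
theorem exists_coordRing_hom {c : k} (hc : c ^ (2 * N + 4) = 1) :
    ∃ φ : CoordRing k (2 * N + 3) →ₐ[k] CoordRing k (2 * N + 3),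
      φ (Ideal.Quotient.mk _ (MvPolynomial.X 0)) = Ideal.Quotient.mk _ (MvPolynomial.X 0) ∧
      φ (Ideal.Quotient.mk _ (MvPolynomial.X 1)) = Ideal.Quotient.mk _ (MvPolynomial.X 1) ∧
      φ (Ideal.Quotient.mk _ (MvPolynomial.X 2)) =
        algebraMap k _ c * Ideal.Quotient.mk _ (MvPolynomial.X 2) := by
  let e : MvPolynomial (Fin 3) k →ₐ[k] MvPolynomial (Fin 3) k := MvPolynomial.aeval
    ![MvPolynomial.X 0, MvPolynomial.X 1, MvPolynomial.C c * MvPolynomial.X 2]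
  have h0 : e (MvPolynomial.X 0) = MvPolynomial.X 0 := by simp [e]
  have h1 : e (MvPolynomial.X 1) = MvPolynomial.X 1 := by simp [e]
  have h2 : e (MvPolynomial.X 2) = MvPolynomial.C c * MvPolynomial.X 2 := by simp [e]
  have h3 : e (MvPolynomial.X 2) ^ (2 * N + 3 + 1) = MvPolynomial.X 2 ^ (2 * N + 3 + 1) := by
    rw [h2, mul_pow, ← map_pow, hc, map_one, one_mul]
  have hle : curveIdeal k (2 * N + 3) ≤ (curveIdeal k (2 * N + 3)).comap e := by
    rw [curveIdeal, Ideal.span_le]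
    rintro f (rfl | rfl)
    · refine Ideal.subset_span (Or.inl ?_)
      simp only [map_sub, map_add, map_mul, map_pow, map_one, h0, h1, h3]
    · refine Ideal.subset_span (Or.inr ?_)
      simp only [map_sub, map_add, map_pow, map_one, h0, h1]
      rfl
  refine ⟨Ideal.quotientMapₐ _ e hle, ?_, ?_, ?_⟩
  · exact congrArg _ h0
  · exact congrArg _ h1
  · refine (congrArg (Ideal.Quotient.mk (curveIdeal k (2 * N + 3))) h2).trans ?_
    rw [map_mul]; rfl

/-- Scaling by c⁻¹ is a left inverse. Injectivity is what lets the map extend to the field of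
fractions. -/
theorem exists_injective_coordRing_hom {c : k} (hc : c ^ (2 * N + 4) = 1) :
    ∃ φ : CoordRing k (2 * N + 3) →ₐ[k] CoordRing k (2 * N + 3), Function.Injective φ ∧
      φ (Ideal.Quotient.mk _ (MvPolynomial.X 0)) = Ideal.Quotient.mk _ (MvPolynomial.X 0) ∧
      φ (Ideal.Quotient.mk _ (MvPolynomial.X 2)) =
        algebraMap k _ c * Ideal.Quotient.mk _ (MvPolynomial.X 2) := by
  obtain ⟨φ, h0, h1, h2⟩ := exists_coordRing_hom hc
  obtain ⟨φ', h0', h1', h2'⟩ := exists_coordRing_hom (c := c⁻¹) (by rw [inv_pow, hc, inv_one])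
  have hc0 : c ≠ 0 := by rintro rfl; simp at hc
  have hcomp : φ'.comp φ = AlgHom.id k _ := by
    refine Ideal.Quotient.algHom_ext k (MvPolynomial.algHom_ext fun i => ?_)
    fin_cases i
    · exact (congrArg φ' h0).trans h0'
    · exact (congrArg φ' h1).trans h1'
    · refine (congrArg φ' h2).trans ?_
      rw [map_mul, AlgHom.commutes, h2', ← mul_assoc, ← map_mul, mul_inv_cancel₀ hc0, map_one,
        one_mul]
      rfl
  refine ⟨φ, ?_, h0, h2⟩
  exact Function.LeftInverse.injective (g := φ') fun a => DFunLike.congr_fun hcomp a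

variable {F : Type*} [Field F] [Algebra (CoordRing k (2 * N + 3)) F]

theorem functionField_equation : (xFun k (2 * N + 3) F ^ (N + 2) + 1) ^ 2 =
    xFun k (2 * N + 3) F * (xFun k (2 * N + 3) F - 1) *
      (xFun k (2 * N + 3) F - tFun k (2 * N + 3) F ^ (2 * N + 4)) := by
  have := congrArg (algebraMap (CoordRing k (2 * N + 3)) F) (coordRing_equation (k := k) (N := N))
  simp only [map_sub, map_add, map_mul, map_pow, map_one] at this
  exact this

variable [Algebra k F] [IsScalarTower k (CoordRing k (2 * N + 3)) F]
  [IsFractionRing (CoordRing k (2 * N + 3)) F]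

theorem adjoin_xFun_tFun :
    IntermediateField.adjoin k {xFun k (2 * N + 3) F, tFun k (2 * N + 3) F} = ⊤ := by
  set L := IntermediateField.adjoin k {xFun k (2 * N + 3) F, tFun k (2 * N + 3) F} with hL
  have hx : xFun k (2 * N + 3) F ∈ L := IntermediateField.subset_adjoin _ _ (by simp)
  have ht : tFun k (2 * N + 3) F ∈ L := IntermediateField.subset_adjoin _ _ (by simp)
  have key (a : CoordRing k (2 * N + 3)) : algebraMap _ F a ∈ L := by
    obtain ⟨p, rfl⟩ := Ideal.Quotient.mk_surjective a
    induction p using MvPolynomial.induction_on with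
    | C c =>
      have : algebraMap (CoordRing k (2 * N + 3)) F (Ideal.Quotient.mk _ (MvPolynomial.C c)) =
          algebraMap k F c := (IsScalarTower.algebraMap_apply k (CoordRing k (2 * N + 3)) F c).symm
      rw [this]; exact L.algebraMap_mem c
    | add p q hp hq => rw [map_add, map_add]; exact add_mem hp hq
    | mul_X p i hp =>
      rw [map_mul, map_mul]
      refine mul_mem hp ?_
      fin_cases i
      · exact hx
      · have := congrArg (algebraMap (CoordRing k (2 * N + 3)) F) (mk_Y_eq (k := k) (N := N))
        rw [map_add, map_pow, map_one] at this
        refine (congrArg (· ∈ L) this).mpr ?_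
        exact add_mem (pow_mem hx _) (one_mem _)
      · exact ht
  rw [eq_top_iff]
  rintro f -
  obtain ⟨a, b, -, rfl⟩ := IsFractionRing.div_surjective (A := CoordRing k (2 * N + 3)) f
  exact div_mem (key a) (key b)

theorem exists_functionField_hom {c : k} (hc : c ^ (2 * N + 4) = 1) :
    ∃ σ : F →+* F, σ (xFun k (2 * N + 3) F) = xFun k (2 * N + 3) F ∧
      σ (tFun k (2 * N + 3) F) = algebraMap k F c * tFun k (2 * N + 3) F ∧
      ∀ a : k, σ (algebraMap k F a) = algebraMap k F a := by
  obtain ⟨φ, hφ, h0, h2⟩ := exists_injective_coordRing_hom hc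
  have hg : Function.Injective ((algebraMap (CoordRing k (2 * N + 3)) F).comp φ.toRingHom) :=
    (IsFractionRing.injective (CoordRing k (2 * N + 3)) F).comp hφ
  refine ⟨IsFractionRing.lift hg, ?_, ?_, fun a => ?_⟩
  · exact (IsFractionRing.lift_algebraMap hg _).trans (congrArg _ h0)
  · refine (IsFractionRing.lift_algebraMap hg _).trans
      ((congrArg (algebraMap (CoordRing k (2 * N + 3)) F) h2).trans ?_)
    rw [map_mul, ← IsScalarTower.algebraMap_apply]; rfl
  · rw [IsScalarTower.algebraMap_apply k (CoordRing k (2 * N + 3)) F]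
    exact (IsFractionRing.lift_algebraMap hg _).trans (congrArg _ (φ.commutes a))

end FunctionField

/-! ### Transcendence of x, and constants in the finite field -/

section Constants

/-- The equation is linear in t^(2N+4) with coefficient -x(x - 1), which is nonzero: x = 0 would
give 1 = 0 and x = 1 would give 4 = 0. So t would be algebraic if x were. -/
theorem transcendental_of_equation {k F : Type*} [Field k] [Field F] [Algebra k F] {x t : F} {N : ℕ}
    (h2 : (2 : k) ≠ 0) (ht : Transcendental k t)
    (hE : (x ^ (N + 2) + 1) ^ 2 = x * (x - 1) * (x - t ^ (2 * N + 4))) :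
    Transcendental k x := by
  intro hx
  have h2' : (2 : F) ≠ 0 := by
    have := (map_ne_zero (algebraMap k F)).2 h2
    rwa [map_ofNat] at this
  have hx0 : x ≠ 0 := by rintro rfl; simp at hE
  have hx1 : x - 1 ≠ 0 := by
    intro h
    rw [sub_eq_zero] at h
    subst h
    rw [one_pow, sub_self, mul_zero, zero_mul, one_add_one_eq_two] at hE
    exact pow_ne_zero 2 h2' hE
  have hxL : x ∈ algebraicClosure k F := (mem_algebraicClosure_iff).2 hx
  have hT : t ^ (2 * N + 4) = x - (x ^ (N + 2) + 1) ^ 2 / (x * (x - 1)) := by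
    field_simp
    linear_combination hE
  have hTL : t ^ (2 * N + 4) ∈ algebraicClosure k F := by
    rw [hT]
    exact sub_mem hxL (div_mem (pow_mem (add_mem (pow_mem hxL _) (one_mem _)) _)
      (mul_mem hxL (sub_mem hxL (one_mem _))))
  exact ht (IsAlgebraic.of_pow (n := 2 * N + 4) (by omega) ((mem_algebraicClosure_iff).1 hTL))

variable {k : Type*} [Field k] [Finite k] {d : ℕ}

theorem two_ne_zero_of_card_modEq (h : Nat.card k ≡ 1 [MOD 2]) : (2 : k) ≠ 0 := by
  have := Fintype.ofFinite k
  intro h2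
  have h0 := FiniteField.cast_card_eq_zero k
  rw [← Nat.card_eq_fintype_card] at h0
  have h3 : Nat.card k = 2 * (Nat.card k / 2) + 1 := by
    have : Nat.card k % 2 = 1 := h
    omega
  rw [h3] at h0
  push_cast at h0
  rw [h2, zero_mul, zero_add] at h0
  exact one_ne_zero h0

/-- With |k| - 1 = 2de and a generator g of the unit group, g^(ed) squares to 1 but is not 1, as ed
is less than the order of g. -/
theorem exists_pow_eq_neg_one (hd : 0 < d) (h : Nat.card k ≡ 1 [MOD 2 * d]) :
    ∃ c : k, c ^ d = -1 := by
  obtain ⟨g, hg⟩ := IsCyclic.exists_ofOrder_eq_natCard (α := kˣ)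
  have hpos : 0 < Nat.card kˣ := Nat.card_pos
  rw [Nat.card_units] at hg hpos
  obtain ⟨e, he⟩ : 2 * d ∣ Nat.card k - 1 := (Nat.modEq_iff_dvd' (by omega)).1 h.symm
  have he0 : 0 < e := Nat.pos_of_ne_zero (by rintro rfl; omega)
  refine ⟨((g ^ e : kˣ) : k), ?_⟩
  have h1 : (((g ^ e : kˣ) : k) ^ d) ^ 2 = 1 := by
    rw [← pow_mul, ← Units.val_pow_eq_pow_val, ← pow_mul]
    have : e * (d * 2) = orderOf g := by rw [hg, he]; ring
    rw [this, pow_orderOf_eq_one, Units.val_one]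
  refine (sq_eq_one_iff.1 h1).resolve_left ?_
  rw [← Units.val_pow_eq_pow_val, ← pow_mul, Units.val_eq_one]
  refine pow_ne_one_of_lt_orderOf (by positivity) ?_
  rw [hg, he]
  nlinarith [Nat.mul_pos hd he0]

end Constants

/-! ### Places over the roots of X² + 1 -/

section Final

variable {k F : Type*} [Field k] [Field F] [Algebra k F] {x t z : F} {N : ℕ}

theorem X_add_C_mul_X_sub_C_of_sq_eq_neg_one {i : k} (hi : i ^ 2 = -1) :
    (X + C i) * (X - C i) = X ^ 2 + 1 := by
  have : C i ^ 2 = -1 := by rw [← C_pow, hi, C_neg, C_1]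
  linear_combination -this

/-- At a pole of x the product (z - i)(z + i) vanishes, so one factor does. If it is the wrong one,
composing the valuation with σ, which sends z to -z, exchanges them. -/
theorem exists_val_sub_lt_one (hx : Transcendental k x) (ht0 : t ≠ 0)
    (hE : (x ^ (N + 2) + 1) ^ 2 = x * (x - 1) * (x - t ^ (2 * N + 4)))
    (hz : z = t⁻¹ ^ (N + 2) * x ^ (N + 1)) {c : k} (hc : c ^ (N + 2) = -1) (σ : F →+* F)
    (hσx : σ x = x) (hσt : σ t = algebraMap k F c * t)
    (hσk : ∀ a : k, σ (algebraMap k F a) = algebraMap k F a) {i : k} (hi : i ^ 2 = -1) :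
    ∃ (B : ValuationSubring F) (w : Valuation F B.ValueGroup),
      (∀ a : k, w (algebraMap k F a) ≤ 1) ∧ 1 < w x ∧ w (aeval z (X - C i)) < 1 := by
  obtain ⟨B, hBk, hBx⟩ := exists_valuationSubring_val_lt_one
    (y := x⁻¹) (fun h => hx (inv_inv x ▸ h.inv))
  have hx0 : x ≠ 0 := by rintro rfl; exact hx isAlgebraic_zero
  have hBx1 : 1 < B.valuation x := by
    rw [map_inv₀] at hBx
    exact (inv_lt_one₀ (zero_lt_iff.2 (B.valuation.ne_zero_iff.2 hx0))).1 hBx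
  obtain ⟨-, h2, -⟩ := val_thirdChart B.valuation hz ht0 hE hBx1
  by_cases h : B.valuation (aeval z (X - C i)) < 1
  · exact ⟨B, B.valuation, hBk, hBx1, h⟩
  have h' : B.valuation (aeval z (X + C i)) < 1 := by
    have h3 : aeval z (X + C i) * aeval z (X - C i) = z ^ 2 + 1 := by
      rw [← map_mul, X_add_C_mul_X_sub_C_of_sq_eq_neg_one hi]; simp
    rw [← h3, map_mul] at h2
    exact lt_of_le_of_lt (le_mul_of_one_le_right' (not_lt.1 h)) h2
  have hσz : σ z = -z := by
    have hcc : (algebraMap k F c)⁻¹ ^ (N + 2) = -1 := by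
      rw [inv_pow, ← map_pow, hc, map_neg, map_one, inv_neg, inv_one]
    rw [hz, map_mul, map_pow, map_pow, map_inv₀, hσx, hσt, mul_inv, mul_pow, hcc]
    ring
  refine ⟨B, B.valuation.comap σ, fun a => ?_, ?_, ?_⟩
  · rw [Valuation.comap_apply, hσk]; exact hBk a
  · rw [Valuation.comap_apply, hσx]; exact hBx1
  · rw [Valuation.comap_apply]
    have : σ (aeval z (X - C i)) = - aeval z (X + C i) := by
      simp only [map_sub, map_add, aeval_X, aeval_C, hσz, hσk]; ring
    rw [this, Valuation.map_neg]
    exact h'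

theorem exists_thirdPlace_of_sq_eq_neg_one (hgen : IntermediateField.adjoin k {x, t} = ⊤)
    (hx : Transcendental k x) (ht0 : t ≠ 0) (h2 : (2 : k) ≠ 0)
    (hE : (x ^ (N + 2) + 1) ^ 2 = x * (x - 1) * (x - t ^ (2 * N + 4)))
    (hz : z = t⁻¹ ^ (N + 2) * x ^ (N + 1)) {c : k} (hc : c ^ (N + 2) = -1) (σ : F →+* F)
    (hσx : σ x = x) (hσt : σ t = algebraMap k F c * t)
    (hσk : ∀ a : k, σ (algebraMap k F a) = algebraMap k F a) {i : k} (hi : i ^ 2 = -1) :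
    ∃ P : Place k F, P.val t = exp (N + 1 : ℤ) ∧ P.val x = exp (N + 2 : ℤ) ∧
      P.val z ≤ 1 ∧ P.val (aeval z (X - C i)) < 1 ∧
      (∀ f, P.val f ≤ 1 → ∃ p : k[X], P.val (f - aeval z p) < 1) ∧
      ∀ P' : Place k F, 1 < P'.val x → P'.val (aeval z (X - C i)) < 1 → P' = P := by
  obtain ⟨B, w, hwk, hwx, hwz⟩ := exists_val_sub_lt_one hx ht0 hE hz hc σ hσx hσt hσk hi
  have hx0 : x ≠ 0 := by rintro rfl; exact hx isAlgebraic_zero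
  have hi0 : i ≠ 0 := by rintro rfl; simp at hi
  refine exists_thirdPlace hgen hx0 ht0 hE hz (irreducible_X_sub_C i)
    (X_add_C_mul_X_sub_C_of_sq_eq_neg_one hi) w hwk hwx hwz ?_
  -- The cofactor z + i equals 2i + (z - i), a nonzero constant plus a vanishing term.
  refine val_eq_one_of_sub_lt_one w (val_algebraMap_eq_one hwk (mul_ne_zero h2 hi0)) ?_
  have : aeval z (X + C i) - algebraMap k F (2 * i) = aeval z (X - C i) := by
    simp only [map_sub, map_add, map_mul, map_ofNat, aeval_X, aeval_C]; ring
  rwa [this]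

theorem exists_thirdPlace_of_not_isSquare (hgen : IntermediateField.adjoin k {x, t} = ⊤)
    (hx : Transcendental k x) (ht0 : t ≠ 0)
    (hE : (x ^ (N + 2) + 1) ^ 2 = x * (x - 1) * (x - t ^ (2 * N + 4)))
    (hz : z = t⁻¹ ^ (N + 2) * x ^ (N + 1)) (hψ : Irreducible (X ^ 2 + 1 : k[X])) :
    ∃ P : Place k F, P.val t = exp (N + 1 : ℤ) ∧ P.val x = exp (N + 2 : ℤ) ∧
      P.val z ≤ 1 ∧ P.val (aeval z (X ^ 2 + 1 : k[X])) < 1 ∧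
      (∀ f, P.val f ≤ 1 → ∃ p : k[X], P.val (f - aeval z p) < 1) ∧
      ∀ P' : Place k F, 1 < P'.val x → P' = P := by
  obtain ⟨B, hBk, hBx⟩ := exists_valuationSubring_val_lt_one
    (y := x⁻¹) (fun h => hx (inv_inv x ▸ h.inv))
  have hx0 : x ≠ 0 := by rintro rfl; exact hx isAlgebraic_zero
  have hBx1 : 1 < B.valuation x := by
    rw [map_inv₀] at hBx
    exact (inv_lt_one₀ (zero_lt_iff.2 (B.valuation.ne_zero_iff.2 hx0))).1 hBx
  have haz : aeval z (X ^ 2 + 1 : k[X]) = z ^ 2 + 1 := by simp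
  obtain ⟨-, h2, -⟩ := val_thirdChart B.valuation hz ht0 hE hBx1
  obtain ⟨P, h3, h4, h5, h6, h7, h8⟩ := exists_thirdPlace hgen hx0 ht0 hE hz hψ (one_mul _)
    B.valuation hBk hBx1 (by rwa [haz]) (by simp)
  refine ⟨P, h3, h4, h5, h6, h7, fun P' hP' => h8 P' hP' ?_⟩
  rw [haz]
  exact (val_thirdChart P'.val hz ht0 hE hP').2.1

theorem irreducible_X_sq_add_one (h : ¬ IsSquare (-1 : k)) : Irreducible (X ^ 2 + 1 : k[X]) := by
  have hdeg : (X ^ 2 + 1 : k[X]).natDegree = 2 := natDegree_X_pow_add_C (r := 1)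
  refine irreducible_of_degree_le_three_of_not_isRoot (by simp [hdeg]) fun a ha => h ⟨a, ?_⟩
  rw [IsRoot.def, eval_add, eval_pow, eval_X, eval_one] at ha
  linear_combination -ha

theorem Place.ord_eq_of_val_eq_exp {P : Place k F} {f : F} {a : ℤ} (h : P.val f = exp a) :
    P.ord f = -a := by
  rw [Place.ord, h, log_exp]

end Final

end LRCurve

/-! ### Places at infinity and the divisor of x -/

theorem mainTheorem7
    (r q m : ℕ) (hr : 3 ≤ r) (hodd : Odd r)
    (hq : IsPrimePow q) (hqr : q ≡ 1 [MOD r + 1]) (hm : 1 ≤ m)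
    {k : Type*} [Field k] [Finite k] (hk : Nat.card k = q ^ m)
    -- `F` is the function field of the curve
    {F : Type*} [Field F] [Algebra k F]
    [Algebra (LRCurve.CoordRing k r) F] [IsScalarTower k (LRCurve.CoordRing k r) F]
    [IsFractionRing (LRCurve.CoordRing k r) F]
    -- `F` is an extension of the rational function field `k(t)`
    [Algebra (RatFunc k) F] [IsScalarTower k (RatFunc k) F]
    (ht : algebraMap (RatFunc k) F RatFunc.X = LRCurve.tFun k r F) :
    let x : F := LRCurve.xFun k r F
    let t : F := LRCurve.tFun k r F
    let Q : LRCurve.Place k (RatFunc k) := LRCurve.placeAtInfinity k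
    -- case 1: `-1` is a square in `k`, with square root `i`
    (∀ i : k, i ^ 2 = -1 →
      ∃ P₁ P₂ P₃ P₄ : LRCurve.Place k F,
        [P₁, P₂, P₃, P₄].Nodup ∧
        {P : LRCurve.Place k F | P.LiesOver Q} = {P₁, P₂, P₃, P₄} ∧
        P₁.LiesOverWith Q 1 1 ∧ P₂.LiesOverWith Q 1 1 ∧
        P₃.LiesOverWith Q ((r - 1) / 2) 1 ∧ P₄.LiesOverWith Q ((r - 1) / 2) 1 ∧
        P₁.BelongsTo t⁻¹ x (r + 1) 1 (Polynomial.X - 1) ∧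
        P₂.BelongsTo t⁻¹ x 0 1 (Polynomial.X - 1) ∧
        P₃.BelongsTo t⁻¹ x (-((r + 1) / 2)) ((r - 1) / 2) (Polynomial.X - Polynomial.C i) ∧
        P₄.BelongsTo t⁻¹ x (-((r + 1) / 2)) ((r - 1) / 2) (Polynomial.X + Polynomial.C i) ∧
        P₁.ord x = r + 1 ∧ P₂.ord x = 0 ∧
        P₃.ord x = -((r + 1) / 2) ∧ P₄.ord x = -((r + 1) / 2) ∧
        LRCurve.Place.IsDivisorOf
          (Finsupp.single P₁ ((r : ℤ) + 1) - Finsupp.single P₃ (((r : ℤ) + 1) / 2)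
            - Finsupp.single P₄ (((r : ℤ) + 1) / 2)) x) ∧
    -- case 2: `-1` is not a square in `k`
    (¬ IsSquare (-1 : k) →
      ∃ P₁ P₂ P₃ : LRCurve.Place k F,
        [P₁, P₂, P₃].Nodup ∧
        {P : LRCurve.Place k F | P.LiesOver Q} = {P₁, P₂, P₃} ∧
        P₁.LiesOverWith Q 1 1 ∧ P₂.LiesOverWith Q 1 1 ∧
        P₃.LiesOverWith Q ((r - 1) / 2) 2 ∧
        P₁.BelongsTo t⁻¹ x (r + 1) 1 (Polynomial.X - 1) ∧
        P₂.BelongsTo t⁻¹ x 0 1 (Polynomial.X - 1) ∧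
        P₃.BelongsTo t⁻¹ x (-((r + 1) / 2)) ((r - 1) / 2) (Polynomial.X ^ 2 + 1) ∧
        P₁.ord x = r + 1 ∧ P₂.ord x = 0 ∧ P₃.ord x = -((r + 1) / 2) ∧
        LRCurve.Place.IsDivisorOf
          (Finsupp.single P₁ ((r : ℤ) + 1) - Finsupp.single P₃ (((r : ℤ) + 1) / 2)) x) := by
  obtain ⟨N, rfl⟩ : ∃ N, r = 2 * N + 3 := by
    obtain ⟨a, rfl⟩ := hodd
    exact ⟨a - 1, by omega⟩
  intro x t Q
  -- The modulus r + 1 equals 2(N + 2): this makes |k| odd and also provides the root of -1 used to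
  -- scale t.
  have hcard : Nat.card k ≡ 1 [MOD 2 * (N + 2)] := by
    have := hqr.pow m
    rw [one_pow, ← hk] at this
    exact this
  have h2 : (2 : k) ≠ 0 := LRCurve.two_ne_zero_of_card_modEq (hcard.of_mul_right (N + 2))
  have hE : (x ^ (N + 2) + 1) ^ 2 = x * (x - 1) * (x - t ^ (2 * N + 4)) :=
    LRCurve.functionField_equation
  have hgen : IntermediateField.adjoin k {x, t} = ⊤ := LRCurve.adjoin_xFun_tFun
  have htr : Transcendental k t := by
    have := (transcendental_algebraMap_iff (R := k)
      (algebraMap (RatFunc k) F).injective).2 RatFunc.transcendental_X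
    rwa [ht] at this
  have hx : Transcendental k x := LRCurve.transcendental_of_equation h2 htr hE
  have ht0 : t ≠ 0 := fun h => htr (h ▸ isAlgebraic_zero)
  have hx0 : x ≠ 0 := fun h => hx (h ▸ isAlgebraic_zero)
  have hover (P : LRCurve.Place k F) : P.LiesOver Q ↔ 1 < P.val t := by
    rw [P.liesOver_placeAtInfinity_iff, ht]
  have hexp {a : ℤ} (ha : 0 < a) : 1 < WithZero.exp a := by
    rw [← WithZero.exp_zero, WithZero.exp_lt_exp]; exact ha
  have hone (P : LRCurve.Place k F) (h : P.val x < 1) : 1 < P.val t := by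
    have := (LRCurve.val_firstChart P.val hE h).2.2
    rw [map_inv₀] at this
    exact (inv_lt_one₀ (zero_lt_iff.2 (P.val.ne_zero_iff.2 ht0))).1 this
  have hnat : (2 * N + 3 - 1) / 2 = N + 1 := by omega
  have hint : (((2 * N + 3 : ℕ) : ℤ) + 1) / 2 = N + 2 := by push_cast; omega
  have hint' : ((2 * N + 3 : ℕ) : ℤ) + 1 = 2 * N + 4 := by push_cast; ring
  obtain ⟨P₁, ht₁, hx₁, hz₁, hψ₁, hres₁, huniq₁⟩ := LRCurve.exists_firstPlace hgen hx ht0 hE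
  obtain ⟨P₂, ht₂, hx₂, hψ₂, hres₂, huniq₂⟩ := LRCurve.exists_secondPlace hgen hx ht0 h2 hE
  have hx₁' : P₁.val x < 1 := by
    rw [hx₁, ← WithZero.exp_zero, WithZero.exp_lt_exp]; omega
  have h12 : P₁ ≠ P₂ := by rintro rfl; exact hx₁'.ne hx₂
  have hdeg : (Polynomial.X - 1 : Polynomial k).natDegree = 1 := Polynomial.natDegree_X_sub_C 1
  have hL₁ : P₁.LiesOverWith Q 1 1 := by
    have := P₁.liesOverWith_placeAtInfinity one_pos (by rw [ht]; exact ht₁)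
      (LRCurve.irreducible_X_sub_one k) hz₁ hψ₁ hres₁
    rwa [hdeg] at this
  have hL₂ : P₂.LiesOverWith Q 1 1 := by
    have := P₂.liesOverWith_placeAtInfinity one_pos (by rw [ht]; exact ht₂)
      (LRCurve.irreducible_X_sub_one k) hx₂.le hψ₂ hres₂
    rwa [hdeg] at this
  have hB₁ : P₁.BelongsTo t⁻¹ x (((2 * N + 3 : ℕ) : ℤ) + 1) 1 (Polynomial.X - 1) := by
    have e : t⁻¹ ^ (-(((2 * N + 3 : ℕ) : ℤ) + 1)) * x ^ 1 = x * t ^ (2 * N + 4) := by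
      rw [pow_one, inv_zpow', neg_neg, mul_comm, ← zpow_natCast t (2 * N + 4)]
      congr 2
    rw [LRCurve.Place.BelongsTo, LRCurve.Place.Vanishes, e]
    exact hψ₁
  have hB₂ : P₂.BelongsTo t⁻¹ x 0 1 (Polynomial.X - 1) := by
    have e : t⁻¹ ^ (-(0 : ℤ)) * x ^ 1 = x := by simp
    rw [LRCurve.Place.BelongsTo, LRCurve.Place.Vanishes, e]
    exact hψ₂
  have ho₁ : P₁.ord x = ((2 * N + 3 : ℕ) : ℤ) + 1 := by
    rw [LRCurve.Place.ord_eq_of_val_eq_exp hx₁, hint', neg_neg]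
  have ho0 (P : LRCurve.Place k F) (h : P.val x = 1) : P.ord x = 0 :=
    LRCurve.Place.ord_eq_of_val_eq_exp (a := 0) h
  set z := t⁻¹ ^ (N + 2) * x ^ (N + 1) with hz
  -- As r is odd, both the integer and the natural divisions by 2 are exact.
  have e₃ : t⁻¹ ^ (-(-((((2 * N + 3 : ℕ) : ℤ) + 1) / 2))) * x ^ ((2 * N + 3 - 1) / 2) = z := by
    rw [neg_neg, hint, hnat, hz]
    congr 1
    exact_mod_cast zpow_natCast t⁻¹ (N + 2)
  have hord (P : LRCurve.Place k F) (hPx : P.val x = WithZero.exp (N + 2 : ℤ)) :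
      P.ord x = -((((2 * N + 3 : ℕ) : ℤ) + 1) / 2) := by
    rw [LRCurve.Place.ord_eq_of_val_eq_exp hPx, hint]
  have hgt (P : LRCurve.Place k F) (hPx : P.val x = WithZero.exp (N + 2 : ℤ)) : 1 < P.val x := by
    rw [hPx]; exact hexp (by omega)
  have hgt' (P : LRCurve.Place k F) (hPt : P.val t = WithZero.exp (N + 1 : ℤ)) : 1 < P.val t := by
    rw [hPt]; exact hexp (by omega)
  have ht₁' : 1 < P₁.val t := hone P₁ hx₁'
  have ht₂' : 1 < P₂.val t := by rw [ht₂]; exact hexp one_pos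
  constructor
  · intro i hi
    obtain ⟨c, hc⟩ := LRCurve.exists_pow_eq_neg_one (Nat.succ_pos (N + 1)) hcard
    obtain ⟨σ, hσx, hσt, hσk⟩ := LRCurve.exists_functionField_hom (k := k) (N := N) (F := F)
      (c := c) (by rw [show 2 * N + 4 = (N + 2) * 2 by ring, pow_mul, hc, neg_one_sq])
    obtain ⟨P₃, ht₃, hx₃, hz₃, hψ₃, hres₃, huniq₃⟩ := LRCurve.exists_thirdPlace_of_sq_eq_neg_one
      hgen hx ht0 h2 hE hz hc σ hσx hσt hσk hi
    obtain ⟨P₄, ht₄, hx₄, hz₄, hψ₄, hres₄, huniq₄⟩ := LRCurve.exists_thirdPlace_of_sq_eq_neg_one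
      hgen hx ht0 h2 hE hz hc σ hσx hσt hσk (i := -i) (by rw [neg_sq, hi])
    have hi0 : i ≠ 0 := by rintro rfl; simp at hi
    -- At a common place both factors of z² + 1 would vanish, hence also their difference, the
    -- nonzero constant 2i.
    have h34 : P₃ ≠ P₄ := by
      rintro rfl
      have h := P₃.val.map_sub_lt hψ₄ hψ₃
      rw [← map_sub] at h
      have e : Polynomial.X - Polynomial.C (-i) - (Polynomial.X - Polynomial.C i) =
          Polynomial.C (2 * i) := by
        rw [map_neg, map_mul, map_ofNat]; ring
      rw [e, Polynomial.aeval_C, P₃.map_const _ (mul_ne_zero h2 hi0)] at h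
      exact lt_irrefl _ h
    have hx₃' := hgt P₃ hx₃
    have hx₄' := hgt P₄ hx₄
    have h13 : P₁ ≠ P₃ := by rintro rfl; exact lt_asymm hx₁' hx₃'
    have h14 : P₁ ≠ P₄ := by rintro rfl; exact lt_asymm hx₁' hx₄'
    have h23 : P₂ ≠ P₃ := by rintro rfl; exact hx₃'.ne' hx₂
    have h24 : P₂ ≠ P₄ := by rintro rfl; exact hx₄'.ne' hx₂
    have hor (P : LRCurve.Place k F) (hP : 1 < P.val x) : P = P₃ ∨ P = P₄ := by
      by_contra! h
      have h3 := not_lt.1 (fun h' => h.1 (huniq₃ P hP h'))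
      have h4 := not_lt.1 (fun h' => h.2 (huniq₄ P hP h'))
      have h5 := (LRCurve.val_thirdChart P.val hz ht0 hE hP).2.1
      have e : z ^ 2 + 1 = Polynomial.aeval z (Polynomial.X - Polynomial.C (-i)) *
          Polynomial.aeval z (Polynomial.X - Polynomial.C i) := by
        rw [← map_mul, map_neg, sub_neg_eq_add, LRCurve.X_add_C_mul_X_sub_C_of_sq_eq_neg_one hi]
        simp
      rw [e, map_mul] at h5
      exact absurd h5 (not_lt.2 (one_le_mul h4 h3))
    have hL (P : LRCurve.Place k F) (j : k) (hPt : P.val t = WithZero.exp (N + 1 : ℤ))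
        (hPz : P.val z ≤ 1)
        (hPψ : P.val (Polynomial.aeval z (Polynomial.X - Polynomial.C j)) < 1)
        (hres : ∀ f, P.val f ≤ 1 → ∃ p : Polynomial k, P.val (f - Polynomial.aeval z p) < 1) :
        P.LiesOverWith Q ((2 * N + 3 - 1) / 2) 1 := by
      have := P.liesOverWith_placeAtInfinity (Nat.succ_pos N) (by rw [ht]; exact_mod_cast hPt)
        (Polynomial.irreducible_X_sub_C j) hPz hPψ hres
      rwa [Polynomial.natDegree_X_sub_C, Nat.succ_eq_add_one, ← hnat] at this
    refine ⟨P₁, P₂, P₃, P₄, by simp [*], ?_, hL₁, hL₂, hL P₃ i ht₃ hz₃ hψ₃ hres₃,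
      hL P₄ (-i) ht₄ hz₄ hψ₄ hres₄, hB₁, hB₂, ?_, ?_, ho₁, ho0 P₂ hx₂, hord P₃ hx₃,
      hord P₄ hx₄, hx0, ?_⟩
    · ext P
      simp only [Set.mem_ofPred_eq, Set.mem_insert_iff, Set.mem_singleton_iff, hover]
      constructor
      · intro hP
        rcases lt_trichotomy (P.val x) 1 with h | h | h
        · exact Or.inl (huniq₁ P h)
        · exact Or.inr (Or.inl (huniq₂ P hP h))
        · exact Or.inr (Or.inr (hor P h))
      · rintro (rfl | rfl | rfl | rfl)
        exacts [ht₁', ht₂', hgt' _ ht₃, hgt' _ ht₄]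
    · rw [LRCurve.Place.BelongsTo, LRCurve.Place.Vanishes, e₃]
      exact hψ₃
    · rw [LRCurve.Place.BelongsTo, LRCurve.Place.Vanishes, e₃]
      rwa [map_neg, sub_neg_eq_add] at hψ₄
    -- Only v(x) matters here: a zero of x is `P₁`, a pole is `P₃` or `P₄`, and at any other place
    -- both sides are 0, whether or not it lies over t = ∞.
    · intro P
      rw [Finsupp.sub_apply, Finsupp.sub_apply]
      rcases lt_trichotomy (P.val x) 1 with h | h | h
      · obtain rfl := huniq₁ P h
        rw [Finsupp.single_eq_same, Finsupp.single_eq_of_ne h13, Finsupp.single_eq_of_ne h14, ho₁]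
        ring
      · have n₁ : P ≠ P₁ := by rintro rfl; exact hx₁'.ne h
        have n₃ : P ≠ P₃ := by rintro rfl; exact hx₃'.ne' h
        have n₄ : P ≠ P₄ := by rintro rfl; exact hx₄'.ne' h
        rw [Finsupp.single_eq_of_ne n₁, Finsupp.single_eq_of_ne n₃, Finsupp.single_eq_of_ne n₄,
          ho0 P h]
        ring
      · rcases hor P h with rfl | rfl
        · rw [Finsupp.single_eq_same, Finsupp.single_eq_of_ne h13.symm,
            Finsupp.single_eq_of_ne h34, hord _ hx₃]
          ring
        · rw [Finsupp.single_eq_same, Finsupp.single_eq_of_ne h14.symm,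
            Finsupp.single_eq_of_ne h34.symm, hord _ hx₄]
          ring
  · intro hsq
    obtain ⟨P₃, ht₃, hx₃, hz₃, hψ₃, hres₃, huniq₃⟩ := LRCurve.exists_thirdPlace_of_not_isSquare
      hgen hx ht0 hE hz (LRCurve.irreducible_X_sq_add_one hsq)
    have hx₃' := hgt P₃ hx₃
    have h13 : P₁ ≠ P₃ := by rintro rfl; exact lt_asymm hx₁' hx₃'
    have h23 : P₂ ≠ P₃ := by rintro rfl; exact hx₃'.ne' hx₂
    have hL₃ : P₃.LiesOverWith Q ((2 * N + 3 - 1) / 2) 2 := by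
      have := P₃.liesOverWith_placeAtInfinity (Nat.succ_pos N) (by rw [ht]; exact_mod_cast ht₃)
        (LRCurve.irreducible_X_sq_add_one hsq) hz₃ hψ₃ hres₃
      have hd : (Polynomial.X ^ 2 + 1 : Polynomial k).natDegree = 2 :=
        Polynomial.natDegree_X_pow_add_C (r := 1)
      rwa [hd, Nat.succ_eq_add_one, ← hnat] at this
    refine ⟨P₁, P₂, P₃, by simp [*], ?_, hL₁, hL₂, hL₃, hB₁, hB₂, ?_, ho₁, ho0 P₂ hx₂,
      hord P₃ hx₃, hx0, ?_⟩
    · ext P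
      simp only [Set.mem_ofPred_eq, Set.mem_insert_iff, Set.mem_singleton_iff, hover]
      constructor
      · intro hP
        rcases lt_trichotomy (P.val x) 1 with h | h | h
        · exact Or.inl (huniq₁ P h)
        · exact Or.inr (Or.inl (huniq₂ P hP h))
        · exact Or.inr (Or.inr (huniq₃ P h))
      · rintro (rfl | rfl | rfl)
        exacts [ht₁', ht₂', hgt' _ ht₃]
    · rw [LRCurve.Place.BelongsTo, LRCurve.Place.Vanishes, e₃]
      exact hψ₃
    · intro P
      rw [Finsupp.sub_apply]
      rcases lt_trichotomy (P.val x) 1 with h | h | h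
      · obtain rfl := huniq₁ P h
        rw [Finsupp.single_eq_same, Finsupp.single_eq_of_ne h13, ho₁]
        ring
      · have n₁ : P ≠ P₁ := by rintro rfl; exact hx₁'.ne h
        have n₃ : P ≠ P₃ := by rintro rfl; exact hx₃'.ne' h
        rw [Finsupp.single_eq_of_ne n₁, Finsupp.single_eq_of_ne n₃, ho0 P h]
        ring
      · obtain rfl := huniq₃ P h
        rw [Finsupp.single_eq_same, Finsupp.single_eq_of_ne h13.symm, hord _ hx₃]
        ring
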